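/- **Theorem (Complexity of solving a game with a linear universal graph).** *Setting.* A graph over a set $C$ of colours is a finite set $V$ of vertices with a finite set $E\subseteq V\times C\times V$ of edges; its size is $|V|$. An objective is a set $\Omega\subseteq C^\omega$; a graph satisfies $\Omega$ if the colour sequence of each of its infinite paths lies in $\Omega$. A game with objective $\Omega$ is a graph whose vertices are partitioned between Eve and Adam; a play is won by Eve if it is infinite with colour sequence in $\Omega$, or if it ends in a sink of Adam. The winning region is the set of vertices from which Eve has a winning strategy. $\Omega$ is positionally determined if in every game with objective $\Omega$ Eve has a positional winning strategy from each vertex of the winning region, and prefix independent if $uw\in\Omega\iff w\in\Omega$ for all $u\in C^*$, $w\in C^\omega$. A graph $\mathcal A=(Q,\Delta)$ is $(n,\Omega)$-universal if it satisfies $\Omega$ and every graph of size at most $n$ that satisfies $\Omega$ has a homomorphism into $\mathcal A$. It is linear if $Q$ has a total order such that ($q\ge q'$ and $(q',c,q'')\in\Delta$) implies $(q,c,q'')\in\Delta$, and ($(q,c,q')\in\Delta$ and $q'\ge q''$) implies $(q,c,q'')\in\Delta$. Put $\delta(q,c)=\max\{q' : (q,c,q')\in\Delta\}\in Q\cup\{\bot\}$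 and $\rho(q',c)=\min\{q : (q,c,q')\in\Delta\}\in Q\cup\{\top\}$, with $\rho(\top,c)=\top$. *Machine model.* A RAM with words of $w=\lfloor\log_2|V|\rfloor+\lfloor\log_2|Q|\rfloor+O(1)$ bits, a constant number of registers, and a read-only input. Vertices and states are numbered arbitrarily; the game is given by arbitrarily ordered linked lists of the outgoing and of the incoming edges of each vertex, which are read through a constant number of cursors. The following take unit time: elementary instructions and tests on words, moving a cursor to the head of a list or to the next edge, reading the endpoints of the edge at a cursor, reading the owner of a vertex, reading $|V|$, $|Q|$ and $\min Q$, comparing two elements of $Q\cup\{\top\}$, and computing $\delta(\cdot,c)$ and $\rho(\cdot,c)$ for the colour $c$ of the edge at a cursor. Space is the number of words of read-write memory. *Statement.* There are a single program and a single constant $K$ such that the following holds for every set $C$ of colours, every positionally determined and prefix independent objective $\Omega\subseteq C^\omega$, every $n\geq 1$, every game $\mathcal G$ of size $n$ with objective $\Omega$, with vertices $V$ and edges $E$, every linear $(n,\Omega)$-universal graph $\mathcal A=(Q,\Delta)$, and every representation of $\mathcal G$ and $\mathcal A$ as above: the program, run with words of $\lfloor\log_2|V|\rfloor+\lfloor\log_2|Q|\rfloor+K$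 bits, halts with the winning region of $\mathcal G$ written in memory as an array of $|V|$ Booleans; it uses at most $K\cdot|V|$ words of memory; and it makes at most $K\cdot(|E|\cdot|Q|+|V|)$ steps, and at most $K\cdot|E|\cdot|Q|$ steps if every vertex is incident with an edge. -/

import Mathlib

namespace UniversalGraphs

/-! ### Graphs, objectives, universal graphs, linear graphs -/

/-- A finite edge-labelled graph on the vertex set `V` with colours in `C`: a finite set of edges
`(v, c, v')`. -/
structure ColGraph (V : Type*) (C : Type*) where
  edges : Finset (V × C × V)

/-- `es` is the list of edges of a finite path of `G` starting at `v`. -/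
def ColGraph.IsPath {V C : Type*} (G : ColGraph V C) : V → List (V × C × V) → Prop
  | _, [] => True
  | v, e :: es => e ∈ G.edges ∧ e.1 = v ∧ G.IsPath e.2.2 es

/-- The last vertex of the finite path that starts at `v` and has the edges `es`. -/
def lastVertex {V C : Type*} : V → List (V × C × V) → V
  | v, [] => v
  | _, e :: es => lastVertex e.2.2 es

/-- `π` is the sequence of edges of an infinite path of `G` starting at `v`. -/
def ColGraph.IsInfPath {V C : Type*} (G : ColGraph V C) (v : V) (π : ℕ → V × C × V) : Prop :=
  (π 0).1 = v ∧ ∀ i, π i ∈ G.edges ∧ (π i).2.2 = (π (i + 1)).1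

/-- The sequence of colours of an infinite path. -/
def colours {V C : Type*} (π : ℕ → V × C × V) : ℕ → C := fun i => (π i).2.1

/-- A graph satisfies the objective `Ω` if all its infinite paths (from any vertex) do. -/
def ColGraph.Satisfies {V C : Type*} (G : ColGraph V C) (Ω : Set (ℕ → C)) : Prop :=
  ∀ v π, G.IsInfPath v π → colours π ∈ Ω

/-- `φ` is a graph homomorphism from `G` to `H`. -/
def ColGraph.IsHom {V W C : Type*} (G : ColGraph V C) (H : ColGraph W C) (φ : V → W) : Prop :=
  ∀ v c v', (v, c, v') ∈ G.edges → (φ v, c, φ v') ∈ H.edges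

/-- `(n, Ω)`-universal graphs. -/
def ColGraph.IsUniversal {Q C : Type*} (A : ColGraph Q C) (n : ℕ) (Ω : Set (ℕ → C)) : Prop :=
  A.Satisfies Ω ∧
    ∀ (V : Type) [Fintype V] (G : ColGraph V C), Fintype.card V ≤ n → G.Satisfies Ω →
      ∃ φ : V → Q, G.IsHom A φ

/-- `A` is linear with respect to the given total order on its vertices: left composition and
right composition. -/
def ColGraph.IsLinear {Q C : Type*} [LinearOrder Q] (A : ColGraph Q C) : Prop :=
  (∀ q q' c q'', q' ≤ q → (q', c, q'') ∈ A.edges → (q, c, q'') ∈ A.edges) ∧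
  (∀ q c q' q'', (q, c, q') ∈ A.edges → q'' ≤ q' → (q, c, q'') ∈ A.edges)

open Classical in
/-- The largest `c`-successor of `q`, or `⊥` if there is none. -/
noncomputable def ColGraph.delta {Q C : Type*} [Fintype Q] [LinearOrder Q] (A : ColGraph Q C)
    (q : Q) (c : C) : WithBot Q :=
  (Finset.univ.filter fun q' => (q, c, q') ∈ A.edges).max

open Classical in
/-- The smallest `c`-predecessor of `q'`, or `⊤` if there is none, extended by `⊤ ↦ ⊤`. -/
noncomputable def ColGraph.rho {Q C : Type*} [Fintype Q] [LinearOrder Q] (A : ColGraph Q C)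
    (q' : WithTop Q) (c : C) : WithTop Q :=
  (Finset.univ.filter fun q => ∃ r : Q, q' = (r : WithTop Q) ∧ (q, c, r) ∈ A.edges).min

/-! ### Games -/

/-- An arena: a graph together with the set of vertices controlled by Eve; the other vertices are
controlled by Adam. A game is an arena together with an objective. -/
structure Arena (V : Type*) (C : Type*) extends ColGraph V C where
  eve : Set V

namespace Arena
variable {V C : Type*} (G : Arena V C)

def IsSink (v : V) : Prop := ∀ e ∈ G.edges, e.1 ≠ v

/-- A strategy maps finite paths (a first vertex and a list of edges) to edges. It is partial, and
where it is defined its value is an outgoing edge of the last vertex of the path. -/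
def IsStrategy (σ : V → List (V × C × V) → Option (V × C × V)) : Prop :=
  ∀ v es e, G.IsPath v es → σ v es = some e → e ∈ G.edges ∧ e.1 = lastVertex v es

/-- Consistency with `σ` of the finite path from `v` with the edges `es`. -/
def Consistent (σ : V → List (V × C × V) → Option (V × C × V)) (v : V)
    (es : List (V × C × V)) : Prop :=
  ∀ (i : ℕ) (h : i < es.length), es[i].1 ∈ G.eve → σ v (es.take i) = some es[i]

/-- Consistency with `σ` of the infinite path from `v` with the edges `π`. -/
def InfConsistent (σ : V → List (V × C × V) → Option (V × C × V)) (v : V)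
    (π : ℕ → V × C × V) : Prop :=
  ∀ i : ℕ, (π i).1 ∈ G.eve → σ v ((List.range i).map π) = some (π i)

/-- `σ` is winning from `v`: every maximal path from `v` that is consistent with `σ` either is
finite and ends in a sink of Adam, or is infinite and satisfies `Ω`. A finite consistent path is
maximal when no consistent path extends it by one edge, since prefixes of consistent paths are
consistent. -/
def WinsFrom (Ω : Set (ℕ → C)) (σ : V → List (V × C × V) → Option (V × C × V)) (v : V) : Prop :=
  (∀ es, G.IsPath v es → G.Consistent σ v es →
    (¬ ∃ e, G.IsPath v (es ++ [e]) ∧ G.Consistent σ v (es ++ [e])) →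
      G.IsSink (lastVertex v es) ∧ lastVertex v es ∉ G.eve) ∧
  (∀ π, G.IsInfPath v π → G.InfConsistent σ v π → colours π ∈ Ω)

/-- The set of vertices from which Eve has a winning strategy for the objective `Ω`. -/
def winningRegion (Ω : Set (ℕ → C)) : Set V :=
  {v | ∃ σ, G.IsStrategy σ ∧ G.WinsFrom Ω σ v}

end Arena

/-- The (partial) strategy that plays according to the last vertex only. -/
def positional {V C : Type*} (f : V → Option (V × C × V)) :
    V → List (V × C × V) → Option (V × C × V) :=
  fun v es => f (lastVertex v es)

/-- Positionally determined objectives (for Eve, over finite games). -/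
def PositionallyDetermined {C : Type*} (Ω : Set (ℕ → C)) : Prop :=
  ∀ (V : Type) [Fintype V] (G : Arena V C), ∀ v ∈ G.winningRegion Ω,
    ∃ f : V → Option (V × C × V), G.IsStrategy (positional f) ∧ G.WinsFrom Ω (positional f) v

/-- The infinite word `u w`. -/
def appendWord {C : Type*} (u : List C) (w : ℕ → C) : ℕ → C :=
  fun i => if h : i < u.length then u[i] else w (i - u.length)

def PrefixIndependent {C : Type*} (Ω : Set (ℕ → C)) : Prop :=
  ∀ (u : List C) (w : ℕ → C), appendWord u w ∈ Ω ↔ w ∈ Ω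

/-! ### Random access machines

The machine has a program that does not depend on the input, word registers, a read-write memory
of `S` words of `w` bits, and a read-only input: the game, given by linked adjacency lists, and the
linear graph, given by unit-cost operations. List pointers into the input are kept in cursor
registers. A program mentions finitely many registers and cursors. -/

/-- A representation of the input: arbitrary numberings of the vertices and of the states, and, for
each vertex, duplicate-free lists (in any order) of its outgoing and of its incoming edges. -/
structure Input {V Q C : Type*} [Fintype V] [Fintype Q] (G : Arena V C) (A : ColGraph Q C) where
  vertexNum : V ≃ Fin (Fintype.card V)
  stateNum : Q ≃ Fin (Fintype.card Q)
  outEdges : V → List (V × C × V)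
  inEdges : V → List (V × C × V)
  outEdges_nodup : ∀ v, (outEdges v).Nodup
  inEdges_nodup : ∀ v, (inEdges v).Nodup
  mem_outEdges : ∀ v e, e ∈ outEdges v ↔ e ∈ G.edges ∧ e.1 = v
  mem_inEdges : ∀ v e, e ∈ inEdges v ↔ e ∈ G.edges ∧ e.2.2 = v

namespace Input
variable {V Q C : Type*} [Fintype V] [Fintype Q] {G : Arena V C} {A : ColGraph Q C}

/-- The vertex with a given number. -/
def vertexAt (I : Input G A) (i : ℕ) : Option V :=
  if h : i < Fintype.card V then some (I.vertexNum.symm ⟨i, h⟩) else none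

/-- The element of `Q ∪ {⊤}` with a given number; the number of `⊤` is `|Q|`. -/
def stateAt (I : Input G A) (i : ℕ) : Option (WithTop Q) :=
  if h : i < Fintype.card Q then some (I.stateNum.symm ⟨i, h⟩ : Q)
  else if i = Fintype.card Q then some ⊤ else none

/-- The number of an element of `Q ∪ {⊤}`. -/
def topNum (I : Input G A) : WithTop Q → ℕ
  | none => Fintype.card Q
  | some q => I.stateNum q

/-- The number of an element of `Q ∪ {⊥}`; the number of `⊥` is also `|Q|`. -/
def botNum (I : Input G A) : WithBot Q → ℕ
  | none => Fintype.card Q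
  | some q => I.stateNum q

end Input

/-- Elementary instructions. The arguments `r s t` are names of word registers, `k` is the name of
a cursor. -/
inductive Instr where
  | nop
  /-- `r := a` -/
  | const (r a : ℕ)
  /-- `r := s` -/
  | copy (r s : ℕ)
  /-- `r := s + t` -/
  | add (r s t : ℕ)
  /-- `r := s - t` (truncated) -/
  | sub (r s t : ℕ)
  /-- `r := mem[s]` -/
  | load (r s : ℕ)
  /-- `mem[r] := s` -/
  | store (r s : ℕ)
  /-- `r := |V|` -/
  | numVertices (r : ℕ)
  /-- `r := |Q|` -/
  | numStates (r : ℕ)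
  /-- `r := min Q` (`⊤` if `Q` is empty) -/
  | minState (r : ℕ)
  /-- `r := 1` if Eve controls vertex `s`, and `r := 0` otherwise -/
  | isEve (r s : ℕ)
  /-- move cursor `k` to the head of the list of outgoing edges of vertex `s` -/
  | outList (k s : ℕ)
  /-- move cursor `k` to the head of the list of incoming edges of vertex `s` -/
  | inList (k s : ℕ)
  /-- advance cursor `k` by one edge -/
  | next (k : ℕ)
  /-- `r :=` source of the edge at cursor `k` -/
  | source (r k : ℕ)
  /-- `r :=` target of the edge at cursor `k` -/
  | target (r k : ℕ)
  /-- `r := δ(s, c)` where `s` is a state and `c` is the colour of the edge at cursor `k` -/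
  | delta (r s k : ℕ)
  /-- `r := ρ(s, c)` where `s` is a state or `⊤` and `c` is the colour of the edge at cursor `k` -/
  | rho (r s k : ℕ)

/-- Tests, for branching. -/
inductive Test where
  | lt (r s : ℕ)
  | eq (r s : ℕ)
  /-- the order of `Q ∪ {⊤}` -/
  | stateLe (r s : ℕ)
  /-- cursor `k` is not at the end of its list -/
  | hasEdge (k : ℕ)

/-- Programs. -/
inductive Prog where
  | instr (i : Instr)
  | seq (p q : Prog)
  | ite (t : Test) (p q : Prog)
  | loop (t : Test) (p : Prog)

/-- The contents of the registers, of the memory and of the cursors; a cursor is represented by the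
part of the list that lies ahead of it. -/
structure Store (V C : Type*) where
  reg : ℕ → ℕ
  mem : ℕ → ℕ
  cur : ℕ → List (V × C × V)

namespace Store
variable {V C : Type*}

def initial (V C : Type*) : Store V C := ⟨fun _ => 0, fun _ => 0, fun _ => []⟩

/-- Write `x` into register `r`; this fails if `x` does not fit in a word of `w` bits. -/
def setReg (w : ℕ) (m : Store V C) (r x : ℕ) : Option (Store V C) :=
  if x < 2 ^ w then some { m with reg := Function.update m.reg r x } else none

def setCur (m : Store V C) (k : ℕ) (l : List (V × C × V)) : Store V C :=
  { m with cur := Function.update m.cur k l }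

end Store

section semantics
variable {V Q C : Type*} [Fintype V] [Fintype Q] [LinearOrder Q] {G : Arena V C}
  {A : ColGraph Q C}

open Classical in
/-- The effect of an instruction on a machine with words of `w` bits and `S` memory cells. The
result is `none` (the machine breaks down) if a value does not fit in a word, an address is not
below `S`, an operand is not the number of an object of the required kind, or a cursor is at the
end of its list. -/
noncomputable def Instr.run (I : Input G A) (w S : ℕ) (m : Store V C) :
    Instr → Option (Store V C)
  | .nop => some m
  | .const r a => m.setReg w r a
  | .copy r s => m.setReg w r (m.reg s)
  | .add r s t => m.setReg w r (m.reg s + m.reg t)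
  | .sub r s t => m.setReg w r (m.reg s - m.reg t)
  | .load r s => if m.reg s < S then m.setReg w r (m.mem (m.reg s)) else none
  | .store r s =>
      if m.reg r < S then some { m with mem := Function.update m.mem (m.reg r) (m.reg s) }
      else none
  | .numVertices r => m.setReg w r (Fintype.card V)
  | .numStates r => m.setReg w r (Fintype.card Q)
  | .minState r => m.setReg w r (I.topNum (Finset.univ : Finset Q).min)
  | .isEve r s => (I.vertexAt (m.reg s)).bind fun v => m.setReg w r (if v ∈ G.eve then 1 else 0)
  | .outList k s => (I.vertexAt (m.reg s)).map fun v => m.setCur k (I.outEdges v)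
  | .inList k s => (I.vertexAt (m.reg s)).map fun v => m.setCur k (I.inEdges v)
  | .next k => (m.cur k).head?.map fun _ => m.setCur k (m.cur k).tail
  | .source r k => (m.cur k).head?.bind fun e => m.setReg w r (I.vertexNum e.1)
  | .target r k => (m.cur k).head?.bind fun e => m.setReg w r (I.vertexNum e.2.2)
  | .delta r s k => (m.cur k).head?.bind fun e =>
      if h : m.reg s < Fintype.card Q then
        m.setReg w r (I.botNum (A.delta (I.stateNum.symm ⟨m.reg s, h⟩) e.2.1))
      else none
  | .rho r s k => (m.cur k).head?.bind fun e =>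
      (I.stateAt (m.reg s)).bind fun x => m.setReg w r (I.topNum (A.rho x e.2.1))

open Classical in
/-- The outcome of a test; `none` if an operand is not the number of an object of the required
kind. -/
noncomputable def Test.eval (I : Input G A) (m : Store V C) : Test → Option Bool
  | .lt r s => some (decide (m.reg r < m.reg s))
  | .eq r s => some (decide (m.reg r = m.reg s))
  | .stateLe r s => (I.stateAt (m.reg r)).bind fun x => (I.stateAt (m.reg s)).map fun y =>
      decide (x ≤ y)
  | .hasEdge k => some (! (m.cur k).isEmpty)

/-- `Exec I w S p m m' T`: on input `I`, with words of `w` bits and `S` memory cells, the program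
`p` started on `m` halts on `m'` after `T` steps, where each elementary instruction and each
evaluation of a test is one step. -/
inductive Exec (I : Input G A) (w S : ℕ) : Prog → Store V C → Store V C → ℕ → Prop
  | instr {i m m'} (h : i.run I w S m = some m') : Exec I w S (.instr i) m m' 1
  | seq {p q m₁ m₂ m₃ T T'} (h : Exec I w S p m₁ m₂ T) (h' : Exec I w S q m₂ m₃ T') :
      Exec I w S (.seq p q) m₁ m₃ (T + T')
  | ite_true {t p q m m' T} (ht : t.eval I m = some true) (h : Exec I w S p m m' T) :
      Exec I w S (.ite t p q) m m' (T + 1)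
  | ite_false {t p q m m' T} (ht : t.eval I m = some false) (h : Exec I w S q m m' T) :
      Exec I w S (.ite t p q) m m' (T + 1)
  | loop_true {t p m₁ m₂ m₃ T T'} (ht : t.eval I m₁ = some true) (h : Exec I w S p m₁ m₂ T)
      (h' : Exec I w S (.loop t p) m₂ m₃ T') : Exec I w S (.loop t p) m₁ m₃ (T + T' + 1)
  | loop_false {t p m} (ht : t.eval I m = some false) : Exec I w S (.loop t p) m m 1

/-- The machine is deterministic: the final store and the number of steps are unique. -/
theorem Exec.unique {I : Input G A} {w S : ℕ} {p : Prog} {m m₁ m₂ : Store V C} {T₁ T₂ : ℕ}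
    (h₁ : Exec I w S p m m₁ T₁) (h₂ : Exec I w S p m m₂ T₂) : m₁ = m₂ ∧ T₁ = T₂ := by
  induction h₁ generalizing m₂ T₂ with
  | instr h => cases h₂ with
    | instr h' => exact ⟨Option.some.inj (h.symm.trans h'), rfl⟩
  | seq _ _ ih ih' => cases h₂ with
    | seq a b =>
      obtain ⟨rfl, rfl⟩ := ih a
      obtain ⟨rfl, rfl⟩ := ih' b
      exact ⟨rfl, rfl⟩
  | ite_true ht _ ih => cases h₂ with
    | ite_true ht' a => obtain ⟨rfl, rfl⟩ := ih a; exact ⟨rfl, rfl⟩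
    | ite_false ht' a => simp [ht] at ht'
  | ite_false ht _ ih => cases h₂ with
    | ite_true ht' a => simp [ht] at ht'
    | ite_false ht' a => obtain ⟨rfl, rfl⟩ := ih a; exact ⟨rfl, rfl⟩
  | loop_true ht _ _ ih ih' => cases h₂ with
    | loop_true ht' a b =>
      obtain ⟨rfl, rfl⟩ := ih a
      obtain ⟨rfl, rfl⟩ := ih' b
      exact ⟨rfl, rfl⟩
    | loop_false ht' => simp [ht] at ht'
  | loop_false ht => cases h₂ with
    | loop_true ht' a b => simp [ht] at ht'
    | loop_false ht' => exact ⟨rfl, rfl⟩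

end semantics

end UniversalGraphs

set_option linter.unusedSimpArgs false

namespace UniversalGraphs

/-! ### The order structure of a linear graph -/

section linear
variable {Q C : Type*} [Fintype Q] [LinearOrder Q] {A : ColGraph Q C}

/-! Call `μ : V → Q ∪ {⊤}` a progress measure if `ρ(μ t, c) ≤ μ v` holds for every edge `(v, c, t)`
of an Adam vertex `v`, and for some edge of each Eve vertex `v` with `μ v ≠ ⊤`. In a linear graph
`ρ(r, c) ≤ q` means that `(q, c, r)` is an edge. So along a play that respects `μ` the finite values
trace a path of `A`, whose colours lie in `Ω`, and Eve wins where `μ` is finite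
(`mem_winningRegion_of_stable`). Conversely, the moves respecting a positional strategy, from the
vertices where it wins, form a graph that satisfies `Ω`. Its homomorphism into `A`, set to `⊤`
elsewhere, is a progress measure (`exists_stable_of_mem_winningRegion`). Hence the winning region is
the set where the least progress measure is finite.

The least measure is reached by lifting unstable vertices, starting from the constant `min Q`. As
`ρ` is monotone, a lift never exceeds a progress measure (`Input.lifted_le`). The unstable vertices
form a stack without repetitions; they are the vertices of support zero. For Eve the support counts
targets of suitable edges rather than edges: parallel edges of different colours are not bounded in
terms of `|V|`, so their number might overflow a word. An array of marks ensures that each neighbour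
is counted once. Values, supports, marks and stack together take `4 |V|` words.

A lift of `v` strictly raises its value and costs a constant times `1 + out(v) + in(v)`
(`wp_liftTop`). A vertex without outgoing edges is lifted at most once, straight to `⊤`; for the
others the summand `1` is absorbed by `out(v)`. A potential turns this into the bound `|V| + 3 |E|
|Q|` on the total weight of the lifts (`Input.potential_lifted`, `Input.sum_potential_le`).

Statements about the machine are total correctness triples `wp`, whose postconditions also see the
number of steps; loop invariants carry a bound on the remaining steps (`wp_loop`). -/

theorem ColGraph.IsLinear.rho_le_coe_iff (hA : A.IsLinear) (q : Q) (x : WithTop Q) (c : C) :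
    A.rho x c ≤ q ↔ ∃ r : Q, x = r ∧ (q, c, r) ∈ A.edges := by
  classical
  constructor
  · intro h
    obtain ⟨p, hp⟩ := WithTop.ne_top_iff_exists.1 (ne_top_of_le_ne_top WithTop.coe_ne_top h)
    have hm := Finset.mem_of_min (s := Finset.univ.filter fun q => ∃ r : Q,
      x = (r : WithTop Q) ∧ (q, c, r) ∈ A.edges) (a := p) (by rw [hp, ColGraph.rho])
    obtain ⟨r, hr, he⟩ := (Finset.mem_filter.1 hm).2
    -- Left composition moves the edge from the least predecessor `p` up to `q`.
    refine ⟨r, hr, hA.1 q p c r ?_ he⟩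
    rw [← hp] at h
    exact_mod_cast h
  · rintro ⟨r, hr, he⟩
    exact Finset.min_le (Finset.mem_filter.2 ⟨Finset.mem_univ _, r, hr, he⟩)

/-- By right composition, lowering the target only adds predecessors, so their minimum can only
drop. -/
theorem ColGraph.IsLinear.rho_mono (hA : A.IsLinear) (c : C) : Monotone fun x => A.rho x c := by
  intro x y hxy
  by_cases hy : A.rho y c = ⊤
  · simp [hy]
  obtain ⟨q, hq⟩ := WithTop.ne_top_iff_exists.1 hy
  obtain ⟨s, rfl, hs⟩ := (hA.rho_le_coe_iff q y c).1 hq.ge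
  obtain ⟨r, rfl⟩ := WithTop.ne_top_iff_exists.1 (ne_top_of_le_ne_top WithTop.coe_ne_top hxy)
  change A.rho r c ≤ A.rho s c
  rw [← hq]
  exact (hA.rho_le_coe_iff q r c).2 ⟨r, rfl, hA.2 q c s r hs (by exact_mod_cast hxy)⟩

end linear

/-! ### Positional strategies -/

theorem ColGraph.isPath_append_singleton {V C : Type*} {G : ColGraph V C} {e : V × C × V} :
    ∀ {v : V} {es : List (V × C × V)},
      G.IsPath v (es ++ [e]) ↔ G.IsPath v es ∧ e ∈ G.edges ∧ e.1 = lastVertex v es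
  | v, [] => by simp [ColGraph.IsPath, lastVertex]
  | v, a :: es => by
      simp [ColGraph.IsPath, lastVertex, isPath_append_singleton (es := es), and_assoc]

theorem lastVertex_map_range {V C : Type*} {v : V} {π : ℕ → V × C × V} (h0 : (π 0).1 = v)
    (h : ∀ i, (π i).2.2 = (π (i + 1)).1) (i : ℕ) :
    lastVertex v ((List.range i).map π) = (π i).1 := by
  induction i generalizing v π with
  | zero => simp [lastVertex, h0]
  | succ i ih =>
    rw [List.range_succ_eq_map, List.map_cons, List.map_map, lastVertex]
    exact ih (π := π ∘ Nat.succ) (h 0).symm fun i => h (i + 1)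

section games
variable {V C : Type*} {G : Arena V C} {Ω : Set (ℕ → C)}

theorem Arena.consistent_cons {f : V → Option (V × C × V)} {v : V} {e : V × C × V}
    {es : List (V × C × V)} : G.Consistent (positional f) v (e :: es) ↔
      (e.1 ∈ G.eve → f v = some e) ∧ G.Consistent (positional f) e.2.2 es := by
  constructor
  · intro h
    refine ⟨fun he => h 0 (by simp) he, fun i hi he => ?_⟩
    exact h (i + 1) (by simpa using hi) (by simpa using he)
  · rintro ⟨h, h'⟩ i hi he
    cases i with
    | zero => exact h he
    | succ i => exact h' i (by simpa using hi) (by simpa using he)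

theorem Arena.infConsistent_positional {f : V → Option (V × C × V)} {v : V}
    {π : ℕ → V × C × V} (hπ : G.IsInfPath v π) :
    G.InfConsistent (positional f) v π ↔ ∀ i, (π i).1 ∈ G.eve → f (π i).1 = some (π i) := by
  simp only [InfConsistent, positional, lastVertex_map_range hπ.1 fun i => (hπ.2 i).2]

/-- Winning positional strategies remain winning along consistent edges. -/
theorem Arena.WinsFrom.step (hΩ : PrefixIndependent Ω) {f : V → Option (V × C × V)}
    {e : V × C × V} (h : G.WinsFrom Ω (positional f) e.1) (he : e ∈ G.edges)
    (hf : e.1 ∈ G.eve → f e.1 = some e) : G.WinsFrom Ω (positional f) e.2.2 := by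
  constructor
  · intro es hp hc hmax
    have := h.1 (e :: es) ⟨he, rfl, hp⟩ (consistent_cons.2 ⟨hf, hc⟩)
    refine this ?_
    rintro ⟨a, ha, ha'⟩
    exact hmax ⟨a, ha.2.2, (consistent_cons.1 ha').2⟩
  · intro π hπ hc
    -- The path `π` with `e` put in front is consistent from `e.1`; prefix independence then removes
    -- the first colour.
    have hπ' : G.IsInfPath e.1 (fun i => Nat.casesOn i e π) :=
      ⟨rfl, fun i => by cases i with
        | zero => exact ⟨he, hπ.1.symm⟩
        | succ i => exact hπ.2 i⟩
    have := h.2 _ hπ' ((infConsistent_positional hπ').2 fun i => by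
      cases i with
      | zero => exact hf
      | succ i => exact (infConsistent_positional hπ).1 hc i)
    rw [← hΩ [e.2.1]]
    convert this using 1
    funext i
    cases i <;> simp [appendWord, colours]

/-- In a vertex of Eve from which it wins, a positional strategy is defined. -/
theorem Arena.WinsFrom.exists_eq_some {f : V → Option (V × C × V)} {v : V}
    (hs : G.IsStrategy (positional f)) (h : G.WinsFrom Ω (positional f) v) (hv : v ∈ G.eve) :
    ∃ e ∈ G.edges, e.1 = v ∧ f v = some e := by
  by_contra! hne
  refine (h.1 [] trivial (fun i hi => by simp at hi) ?_).2 hv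
  rintro ⟨e, hp, hc⟩
  have hf := (consistent_cons.1 hc).1 (by simpa [hp.2.1] using hv)
  have := hs v [] e trivial hf
  exact hne e this.1 this.2 hf

/-! ### Progress measures and winning vertices -/

variable {Q : Type*} [Fintype Q] [LinearOrder Q] {A : ColGraph Q C}

variable (G A) in
/-- `μ` is a progress measure at the vertex `v`. -/
def StableAt (μ : V → WithTop Q) (v : V) : Prop :=
  (v ∈ G.eve → μ v = ⊤ ∨ ∃ c t, (v, c, t) ∈ G.edges ∧ A.rho (μ t) c ≤ μ v) ∧
  (v ∉ G.eve → ∀ c t, (v, c, t) ∈ G.edges → A.rho (μ t) c ≤ μ v)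

open Classical in
/-- Eve wins from the vertices where a progress measure is finite. -/
theorem mem_winningRegion_of_stable (hA : A.IsLinear) (hΩ : A.Satisfies Ω)
    {μ : V → WithTop Q} (hμ : ∀ v, StableAt G A μ v) {v : V} (hv : μ v ≠ ⊤) :
    v ∈ G.winningRegion Ω := by
  -- Eve's strategy picks any edge that witnesses stability.
  let P : V → V × C × V → Prop := fun u e =>
    e ∈ G.edges ∧ e.1 = u ∧ A.rho (μ e.2.2) e.2.1 ≤ μ u
  let f : V → Option (V × C × V) := fun u => if h : ∃ e, P u e then some h.choose else none
  have hf : ∀ {u e}, f u = some e → P u e := by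
    intro u e h
    by_cases h' : ∃ e, P u e
    · simp only [f, h', dite_true, Option.some.injEq] at h
      exact h ▸ h'.choose_spec
    · exact absurd (h.symm.trans (dif_neg h')) (by simp)
  have hdef : ∀ {u}, u ∈ G.eve → μ u ≠ ⊤ → ∃ e, f u = some e := by
    intro u hu hu'
    obtain h | ⟨c, t, h, h'⟩ := (hμ u).1 hu
    · exact absurd h hu'
    · have : ∃ e, P u e := ⟨(u, c, t), h, rfl, h'⟩
      exact ⟨_, dif_pos this⟩
  have hedge : ∀ {e : V × C × V}, e ∈ G.edges → μ e.1 ≠ ⊤ → (e.1 ∈ G.eve → f e.1 = some e) →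
      A.rho (μ e.2.2) e.2.1 ≤ μ e.1 := by
    intro e he _ hfe
    by_cases hev : e.1 ∈ G.eve
    · exact (hf (hfe hev)).2.2
    · exact (hμ e.1).2 hev e.2.1 e.2.2 he
  -- Finiteness propagates along consistent edges, and each such edge maps to an edge of `A`. This
  -- settles finite and infinite plays alike.
  have htrans : ∀ {e : V × C × V}, e ∈ G.edges → μ e.1 ≠ ⊤ → (e.1 ∈ G.eve → f e.1 = some e) →
      ∃ q r : Q, μ e.1 = q ∧ μ e.2.2 = r ∧ (q, e.2.1, r) ∈ A.edges := by
    intro e he hne hfe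
    obtain ⟨q, hq⟩ := WithTop.ne_top_iff_exists.1 hne
    have h := hedge he hne hfe
    rw [← hq] at h
    obtain ⟨r, hr, h⟩ := (hA.rho_le_coe_iff _ _ _).1 h
    exact ⟨q, r, hq.symm, hr, h⟩
  refine ⟨positional f, fun u es e _ h => ⟨(hf h).1, (hf h).2.1⟩, ?_, ?_⟩
  · intro es
    induction es generalizing v with
    | nil =>
      intro _ _ hmax
      by_cases hev : v ∈ G.eve
      · obtain ⟨e, he⟩ := hdef hev hv
        refine absurd ⟨e, ⟨(hf he).1, (hf he).2.1, trivial⟩, ?_⟩ hmax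
        exact Arena.consistent_cons.2 ⟨fun _ => he, fun i hi => by simp at hi⟩
      · refine ⟨fun e he hev' => hmax ⟨e, ⟨he, hev', trivial⟩, ?_⟩, hev⟩
        exact Arena.consistent_cons.2
          ⟨fun h => absurd ((show e.1 = v from hev') ▸ h) hev, fun i hi => by simp at hi⟩
    | cons e es ih =>
      rintro ⟨he, rfl, hp⟩ hc hmax
      rw [Arena.consistent_cons] at hc
      obtain ⟨q, r, hq, hr, -⟩ := htrans he hv hc.1
      refine ih (v := e.2.2) (by simp [hr]) hp hc.2 ?_
      rintro ⟨a, ha, ha'⟩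
      exact hmax ⟨a, ⟨he, rfl, ha⟩, Arena.consistent_cons.2 ⟨hc.1, ha'⟩⟩
  · intro π hπ hc
    rw [Arena.infConsistent_positional hπ] at hc
    have hfin : ∀ i, μ (π i).1 ≠ ⊤ := by
      intro i
      induction i with
      | zero => rwa [hπ.1]
      | succ i ih =>
        obtain ⟨q, r, -, hr, -⟩ := htrans (hπ.2 i).1 ih (hc i)
        rw [← (hπ.2 i).2, hr]
        exact WithTop.coe_ne_top
    choose q hq using fun i => WithTop.ne_top_iff_exists.1 (hfin i)
    refine hΩ (q 0) (fun i => (q i, (π i).2.1, q (i + 1))) ⟨rfl, fun i => ⟨?_, rfl⟩⟩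
    obtain ⟨x, r, hx, hr, h⟩ := htrans (hπ.2 i).1 (hfin i) (hc i)
    rw [← hq i, WithTop.coe_inj] at hx
    rw [(hπ.2 i).2, ← hq (i + 1), WithTop.coe_inj] at hr
    change (q i, (π i).2.1, q (i + 1)) ∈ A.edges
    rwa [hx, hr]

end games

open Classical in
/-- For a vertex of the winning region there is a progress measure which is finite there. -/
theorem exists_stable_of_mem_winningRegion {C : Type*} {Ω : Set (ℕ → C)}
    (hpos : PositionallyDetermined Ω) (hpre : PrefixIndependent Ω) {V : Type} [Fintype V]
    {G : Arena V C} {Q : Type*} [Fintype Q] [LinearOrder Q] {A : ColGraph Q C}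
    (hA : A.IsLinear) (hU : A.IsUniversal (Fintype.card V) Ω) {v : V}
    (hv : v ∈ G.winningRegion Ω) :
    ∃ μ : V → WithTop Q, (∀ u, StableAt G A μ u) ∧ μ v ≠ ⊤ := by
  obtain ⟨f, hs, hw⟩ := hpos V G v hv
  let W : Set V := {u | G.WinsFrom Ω (positional f) u}
  -- All moves from the vertices where `f` wins, with Eve's moves restricted to `f`. An infinite
  -- path of `H` starts in `W` and is consistent with `f`.
  let H : ColGraph V C :=
    ⟨G.edges.filter fun e => e.1 ∈ W ∧ (e.1 ∈ G.eve → f e.1 = some e)⟩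
  have hH : H.Satisfies Ω := by
    rintro u π ⟨h0, h⟩
    simp only [H, Finset.mem_filter] at h
    have hπ : G.IsInfPath u π := ⟨h0, fun i => ⟨(h i).1.1, (h i).2⟩⟩
    have hu : u ∈ W := h0 ▸ (h 0).1.2.1
    exact hu.2 π hπ ((Arena.infConsistent_positional hπ).2 fun i => (h i).1.2.2)
  obtain ⟨φ, hφ⟩ := hU.2 V H le_rfl hH
  have key : ∀ e ∈ G.edges, e.1 ∈ W → (e.1 ∈ G.eve → f e.1 = some e) →
      e.2.2 ∈ W ∧ A.rho (φ e.2.2) e.2.1 ≤ φ e.1 := fun e he heW hfe =>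
    ⟨Arena.WinsFrom.step hpre heW he hfe, (hA.rho_le_coe_iff _ _ _).2
      ⟨_, rfl, hφ _ _ _ (Finset.mem_filter.2 ⟨he, heW, hfe⟩)⟩⟩
  -- Outside `W` the value `⊤` makes stability trivial; inside, consistent moves stay in `W`, so
  -- only values of `φ` are compared.
  refine ⟨fun u => if u ∈ W then (φ u : WithTop Q) else ⊤, fun u => ?_,
    by simp [show v ∈ W from hw]⟩
  by_cases hu : u ∈ W
  · refine ⟨fun hev => Or.inr ?_, fun hev c t he => ?_⟩
    · obtain ⟨⟨_, c, t⟩, he, rfl, hfe⟩ := Arena.WinsFrom.exists_eq_some hs hu hev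
      obtain ⟨h, h'⟩ := key _ he hu fun _ => hfe
      exact ⟨c, t, he, by simpa [h, hu] using h'⟩
    · obtain ⟨h, h'⟩ := key _ he hu fun h => absurd h hev
      simpa [hu, show t ∈ W from h] using h'
  · exact ⟨fun _ => Or.inl (by simp [hu]), fun _ c t _ => by simp [hu]⟩

/-! ### Lifting -/

section folds
variable {α β : Type*} [LinearOrder β] {g : α → β}

theorem lt_foldl_min_iff {y : β} : ∀ {l : List α} {x : β},
    y < l.foldl (fun x e => min (g e) x) x ↔ y < x ∧ ∀ e ∈ l, y < g e
  | [], x => by simp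
  | a :: l, x => by
    rw [List.foldl_cons, lt_foldl_min_iff, lt_min_iff, List.forall_mem_cons]
    tauto

theorem foldl_min_le_iff {y : β} {l : List α} {x : β} :
    l.foldl (fun x e => min (g e) x) x ≤ y ↔ x ≤ y ∨ ∃ e ∈ l, g e ≤ y := by
  rw [← not_lt, lt_foldl_min_iff, not_and_or]
  simp

theorem foldl_max_le_iff {y : β} : ∀ {l : List α} {x : β},
    l.foldl (fun x e => max (g e) x) x ≤ y ↔ x ≤ y ∧ ∀ e ∈ l, g e ≤ y
  | [], x => by simp
  | a :: l, x => by
    rw [List.foldl_cons, foldl_max_le_iff, max_le_iff, List.forall_mem_cons]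
    tauto

end folds

section lifting
variable {V Q C : Type*} [Fintype V] [Fintype Q] [LinearOrder Q] {G : Arena V C}
  {A : ColGraph Q C}

open Classical in
variable (G A) in
/-- The number of reasons for which `μ` is a progress measure at `v`. For a vertex of Eve these are
the targets of suitable edges, and the value `⊤`. -/
noncomputable def support (μ : V → WithTop Q) (v : V) : ℕ :=
  if v ∈ G.eve then (if μ v = ⊤ then 1 else 0) +
    (Finset.univ.filter fun t => ∃ c, (v, c, t) ∈ G.edges ∧ A.rho (μ t) c ≤ μ v).card
  else if ∀ c t, (v, c, t) ∈ G.edges → A.rho (μ t) c ≤ μ v then 1 else 0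

theorem support_eq_zero_iff {μ : V → WithTop Q} {v : V} :
    support G A μ v = 0 ↔ ¬ StableAt G A μ v := by
  by_cases hv : v ∈ G.eve
  · simp [support, hv, StableAt, Finset.filter_eq_empty_iff]
    grind
  · simp [support, hv, StableAt]

/-- Only the target `v` can change its status, and monotonicity of `ρ` allows it only to be lost. As
`u ≠ v`, the threshold `μ u` is unaffected. -/
theorem support_update_of_eve {μ : V → WithTop Q} {u v : V} {x : WithTop Q} [DecidableEq V]
    (hA : A.IsLinear) (hx : μ v ≤ x) (huv : u ≠ v) (hu : u ∈ G.eve) :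
    support G A μ u = support G A (Function.update μ v x) u +
      open Classical in if (∃ c, (u, c, v) ∈ G.edges ∧ A.rho (μ v) c ≤ μ u) ∧
        ¬ (∃ c, (u, c, v) ∈ G.edges ∧ A.rho x c ≤ μ u) then 1 else 0 := by
  classical
  simp only [support, hu, if_true, Function.update_of_ne huv, add_assoc]
  congr 1
  set S := Finset.univ.filter fun t => ∃ c, (u, c, t) ∈ G.edges ∧ A.rho (μ t) c ≤ μ u
  set S' := Finset.univ.filter fun t =>
    ∃ c, (u, c, t) ∈ G.edges ∧ A.rho (Function.update μ v x t) c ≤ μ u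
  have hne : ∀ t, t ≠ v → (t ∈ S' ↔ t ∈ S) := fun t ht => by
    simp [S, S', Function.update_of_ne ht]
  have hv : v ∈ S ↔ ∃ c, (u, c, v) ∈ G.edges ∧ A.rho (μ v) c ≤ μ u := by simp [S]
  have hv' : v ∈ S' ↔ ∃ c, (u, c, v) ∈ G.edges ∧ A.rho x c ≤ μ u := by simp [S']
  have hsub : v ∈ S' → v ∈ S := by
    rw [hv, hv']
    rintro ⟨c, he, hc⟩
    exact ⟨c, he, (hA.rho_mono c hx).trans hc⟩
  rw [← hv, ← hv']
  split_ifs with h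
  · rw [← Finset.card_insert_of_notMem h.2]
    congr 1
    ext t
    by_cases ht : t = v
    · simp [ht, h.1]
    · simp [ht, hne t ht]
  · rw [add_zero]
    congr 1
    ext t
    by_cases ht : t = v
    · subst ht; tauto
    · exact (hne t ht).symm

/-- Raising the value of `v` can only break conditions, so the Boolean support drops exactly when
some edge into `v` now fails. -/
theorem support_update_of_not_eve {μ : V → WithTop Q} {u v : V} {x : WithTop Q} [DecidableEq V]
    (hA : A.IsLinear) (hx : μ v ≤ x) (huv : u ≠ v) (hu : u ∉ G.eve) :
    support G A (Function.update μ v x) u =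
      open Classical in if ∃ c, (u, c, v) ∈ G.edges ∧ ¬ A.rho x c ≤ μ u then 0
        else support G A μ u := by
  classical
  simp only [support, hu, if_false, Function.update_of_ne huv]
  split_ifs with h₁ h₂ h₃ h₂ h₃
  · obtain ⟨c, he, hc⟩ := h₂
    exact absurd (by simpa using h₁ c v he) hc
  · rfl
  · refine absurd (fun c t he => ?_) h₃
    by_cases ht : t = v
    · subst ht
      exact (hA.rho_mono c hx).trans (by simpa using h₁ c t he)
    · simpa [ht] using h₁ c t he
  · rfl
  · refine absurd (fun c t he => ?_) h₁
    by_cases ht : t = v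
    · subst ht
      by_contra hc
      exact h₂ ⟨c, he, by simpa using hc⟩
    · simpa [ht] using h₃ c t he
  · rfl

/-! ### Lifting one vertex, and the potential that pays for it -/

variable (I : Input G A)

open Classical in
/-- The value to which `μ` is raised at `v`. -/
noncomputable def Input.lifted (μ : V → WithTop Q) (v : V) : WithTop Q :=
  if v ∈ G.eve then
    (I.outEdges v).foldl (fun x e => min (A.rho (μ e.2.2) e.2.1) x) ⊤
  else
    (I.outEdges v).foldl (fun x e => max (A.rho (μ e.2.2) e.2.1) x) (μ v)

/-- Lifting is monotone in the measure and does not exceed a measure that is stable at the vertex.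
Hence lifts stay below every progress measure. -/
theorem Input.lifted_le (hA : A.IsLinear) {μ ν : V → WithTop Q} (h : μ ≤ ν) {v : V}
    (hν : StableAt G A ν v) : I.lifted μ v ≤ ν v := by
  by_cases hv : v ∈ G.eve
  · rw [Input.lifted, if_pos hv, foldl_min_le_iff]
    obtain h' | ⟨c, t, he, hc⟩ := hν.1 hv
    · simp [h']
    · exact Or.inr ⟨_, (I.mem_outEdges _ _).2 ⟨he, rfl⟩, (hA.rho_mono c (h t)).trans hc⟩
  · rw [Input.lifted, if_neg hv, foldl_max_le_iff]
    refine ⟨h v, fun ⟨u, c, t⟩ he => ?_⟩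
    obtain ⟨he', rfl⟩ := (I.mem_outEdges _ _).1 he
    exact (hA.rho_mono c (h t)).trans (hν.2 hv c t he')

theorem Input.lt_lifted {μ : V → WithTop Q} {v : V} (hv : ¬ StableAt G A μ v) :
    μ v < I.lifted μ v := by
  by_cases hev : v ∈ G.eve
  · rw [Input.lifted, if_pos hev, lt_foldl_min_iff]
    have h : ¬ (μ v = ⊤ ∨ ∃ c t, (v, c, t) ∈ G.edges ∧ A.rho (μ t) c ≤ μ v) := by
      simpa [StableAt, hev] using hv
    push Not at h
    refine ⟨lt_top_iff_ne_top.2 h.1, fun ⟨u, c, t⟩ he => ?_⟩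
    obtain ⟨he', rfl⟩ := (I.mem_outEdges _ _).1 he
    exact h.2 c t he'
  · rw [Input.lifted, if_neg hev, ← not_le, foldl_max_le_iff]
    rintro ⟨-, h⟩
    exact hv ⟨fun h => absurd h hev, fun _ c t he => h _ ((I.mem_outEdges _ _).2 ⟨he, rfl⟩)⟩

/-- A sink of Adam is always stable, and for a sink of Eve the minimum is over the empty list. -/
theorem Input.lifted_eq_top {μ : V → WithTop Q} {v : V} (hv : ¬ StableAt G A μ v)
    (h : I.outEdges v = []) : I.lifted μ v = ⊤ := by
  by_cases hev : v ∈ G.eve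
  · simp [Input.lifted, hev, h]
  · refine absurd ⟨fun h => absurd h hev, fun _ c t he => ?_⟩ hv
    have := (I.mem_outEdges v _).2 ⟨he, rfl⟩
    simp [h] at this

/-- The size of the neighbourhood of a vertex. -/
def Input.weight (v : V) : ℕ := 1 + (I.outEdges v).length + (I.inEdges v).length

open Classical in
/-- A bound on the total weight of the future lifts of `v`. -/
noncomputable def Input.potential (x : WithTop Q) (v : V) : ℕ :=
  (if x = ⊤ then 0 else 1) + (Finset.univ.filter fun y => x < y).card *
    (2 * (I.outEdges v).length + (I.inEdges v).length)

/-- At least one value above `μ v` is used up, which frees `2 * out + in`. If `out` is positive this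
covers the weight `1 + out + in`; otherwise the vertex jumps to `⊤` and the missing `1` comes from
the first summand of the potential. -/
theorem Input.potential_lifted {μ : V → WithTop Q} {v : V} (hv : ¬ StableAt G A μ v) :
    I.potential (I.lifted μ v) v + I.weight v ≤ I.potential (μ v) v := by
  classical
  have hlt := I.lt_lifted hv
  have hcard : (Finset.univ.filter fun y => I.lifted μ v < y).card + 1 ≤
      (Finset.univ.filter fun y => μ v < y).card := by
    rw [Nat.succ_le_iff]
    refine Finset.card_lt_card ((Finset.ssubset_iff_of_subset ?_).2 ⟨I.lifted μ v, ?_, ?_⟩)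
    · intro y hy
      simp only [Finset.mem_filter, Finset.mem_univ, true_and] at hy ⊢
      exact hlt.trans hy
    · simpa using hlt
    · simp
  have hmul := Nat.mul_le_mul_right (2 * (I.outEdges v).length + (I.inEdges v).length) hcard
  rw [Nat.add_mul, one_mul] at hmul
  have htop : μ v ≠ ⊤ := hlt.ne_top
  rw [Input.potential, Input.potential, if_neg htop, Input.weight]
  by_cases h : I.outEdges v = []
  · rw [I.lifted_eq_top hv h, if_pos rfl]
    rw [I.lifted_eq_top hv h] at hmul
    have : (I.outEdges v).length = 0 := by simp [h]
    omega
  · have : 0 < (I.outEdges v).length := List.length_pos_iff.2 h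
    split_ifs <;> omega

theorem Input.sum_potential_update [DecidableEq V] {μ : V → WithTop Q} {v : V}
    (hv : ¬ StableAt G A μ v) :
    ∑ u, I.potential (Function.update μ v (I.lifted μ v) u) u + I.weight v ≤
      ∑ u, I.potential (μ u) u := by
  rw [← Finset.add_sum_erase _ _ (Finset.mem_univ v), ← Finset.add_sum_erase _ _
    (Finset.mem_univ v), Function.update_self, Finset.sum_congr rfl (g := fun u =>
      I.potential (μ u) u) fun u hu => by rw [Function.update_of_ne (Finset.ne_of_mem_erase hu)]]
  have := I.potential_lifted hv
  omega

omit [LinearOrder Q] in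
theorem Input.sum_length_outEdges : ∑ v, (I.outEdges v).length = G.edges.card := by
  classical
  rw [Finset.card_eq_sum_card_fiberwise (f := fun e : V × C × V => e.1) (t := Finset.univ)
    (fun _ _ => Finset.mem_coe.2 (Finset.mem_univ _))]
  refine Finset.sum_congr rfl fun v _ => ?_
  rw [← List.toFinset_card_of_nodup (I.outEdges_nodup v)]
  congr 1
  ext e
  simp [I.mem_outEdges]

omit [LinearOrder Q] in
theorem Input.sum_length_inEdges : ∑ v, (I.inEdges v).length = G.edges.card := by
  classical
  rw [Finset.card_eq_sum_card_fiberwise (f := fun e : V × C × V => e.2.2) (t := Finset.univ)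
    (fun _ _ => Finset.mem_coe.2 (Finset.mem_univ _))]
  refine Finset.sum_congr rfl fun v _ => ?_
  rw [← List.toFinset_card_of_nodup (I.inEdges_nodup v)]
  congr 1
  ext e
  simp [I.mem_inEdges]

theorem Input.sum_potential_le [Nonempty Q] :
    ∑ v, I.potential (Finset.univ : Finset Q).min v ≤
      Fintype.card V + 3 * (G.edges.card * Fintype.card Q) := by
  classical
  -- `Q ∪ {⊤}` has `|Q| + 1` elements, and the minimum is not above itself.
  have hcard : (Finset.univ.filter fun y => (Finset.univ : Finset Q).min < y).card ≤
      Fintype.card Q := by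
    have h := Finset.card_lt_card (Finset.filter_ssubset.2
      ⟨_, Finset.mem_univ _, lt_irrefl (Finset.univ : Finset Q).min⟩)
    rw [Finset.card_univ, show Fintype.card (WithTop Q) = Fintype.card Q + 1 from
      Fintype.card_option] at h
    exact Nat.lt_succ_iff.1 h
  calc
    _ ≤ ∑ v, (1 + Fintype.card Q * (2 * (I.outEdges v).length + (I.inEdges v).length)) := by
      refine Finset.sum_le_sum fun v _ => Nat.add_le_add ?_ (Nat.mul_le_mul_right _ hcard)
      split_ifs <;> omega
    _ = _ := by
      rw [Finset.sum_add_distrib, ← Finset.mul_sum, Finset.sum_add_distrib, ← Finset.mul_sum,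
        I.sum_length_outEdges, I.sum_length_inEdges]
      simp
      ring

end lifting

/-! ### A calculus for programs -/

section calculus
variable {V Q C : Type*} [Fintype V] [Fintype Q] [LinearOrder Q] {G : Arena V C}
  {A : ColGraph Q C} {I : Input G A} {w S : ℕ}

/-- The program `p` started on `m` halts, and its final store and number of steps satisfy `P`. -/
def wp (I : Input G A) (w S : ℕ) (p : Prog) (m : Store V C) (P : Store V C → ℕ → Prop) : Prop :=
  ∃ m' T, Exec I w S p m m' T ∧ P m' T

theorem wp.mono {p : Prog} {m : Store V C} {P P' : Store V C → ℕ → Prop}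
    (h : wp I w S p m P) (h' : ∀ m' T, P m' T → P' m' T) : wp I w S p m P' := by
  obtain ⟨m', T, he, hP⟩ := h
  exact ⟨m', T, he, h' _ _ hP⟩

@[simp] theorem wp_seq {p q : Prog} {m : Store V C} {P : Store V C → ℕ → Prop} :
    wp I w S (.seq p q) m P ↔
      wp I w S p m fun m' T => wp I w S q m' fun m'' T' => P m'' (T + T') := by
  constructor
  · rintro ⟨_, _, h, hP⟩
    cases h with | seq h h' => exact ⟨_, _, h, _, _, h', hP⟩
  · rintro ⟨_, _, h, _, _, h', hP⟩
    exact ⟨_, _, .seq h h', hP⟩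

theorem wp_instr {i : Instr} {m : Store V C} {P : Store V C → ℕ → Prop} :
    wp I w S (.instr i) m P ↔ ∃ m', i.run I w S m = some m' ∧ P m' 1 := by
  constructor
  · rintro ⟨_, _, ⟨h⟩, hP⟩
    exact ⟨_, h, hP⟩
  · rintro ⟨_, h, hP⟩
    exact ⟨_, _, .instr h, hP⟩

theorem wp_ite {t : Test} {p q : Prog} {m : Store V C} {P : Store V C → ℕ → Prop} {b : Bool}
    (hb : t.eval I m = some b) : wp I w S (.ite t p q) m P ↔
      (b = true → wp I w S p m fun m' T => P m' (T + 1)) ∧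
      (b = false → wp I w S q m fun m' T => P m' (T + 1)) := by
  constructor
  · rintro ⟨_, _, h, hP⟩
    cases h with
    | ite_true ht h =>
      obtain rfl := Option.some.inj (hb.symm.trans ht)
      exact ⟨fun _ => ⟨_, _, h, hP⟩, fun h => by simp at h⟩
    | ite_false ht h =>
      obtain rfl := Option.some.inj (hb.symm.trans ht)
      exact ⟨fun h => by simp at h, fun _ => ⟨_, _, h, hP⟩⟩
  · rintro ⟨h, h'⟩
    cases b with
    | true => obtain ⟨_, _, h, hP⟩ := h rfl; exact ⟨_, _, .ite_true hb h, hP⟩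
    | false => obtain ⟨_, _, h, hP⟩ := h' rfl; exact ⟨_, _, .ite_false hb h, hP⟩

/-- The rule for loops; the invariant includes a bound on the number of the remaining steps. -/
theorem wp_loop {t : Test} {p : Prog} (J : ℕ → Store V C → Prop) {φ : ℕ} {m : Store V C}
    {P : Store V C → ℕ → Prop} (h0 : J φ m)
    (hJ : ∀ φ m, J φ m → ∃ b, t.eval I m = some b ∧ 1 ≤ φ ∧
      (b = true → wp I w S p m fun m' T => ∃ φ', φ' + T + 1 ≤ φ ∧ J φ' m'))
    (hP : ∀ φ' m' T, T ≤ φ → J φ' m' → t.eval I m' = some false → P m' T) :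
    wp I w S (.loop t p) m P := by
  suffices ∃ m' T, Exec I w S (.loop t p) m m' T ∧ T ≤ φ ∧ t.eval I m' = some false ∧
      ∃ φ', J φ' m' by
    obtain ⟨m', T, h, hT, ht, φ', h'⟩ := this
    exact ⟨m', T, h, hP _ _ _ hT h' ht⟩
  clear hP
  induction φ using Nat.strong_induction_on generalizing m with
  | _ φ ih =>
    obtain ⟨b, hb, hφ, hbody⟩ := hJ φ m h0
    cases b with
    | false => exact ⟨m, 1, .loop_false hb, hφ, hb, φ, h0⟩
    | true =>
      obtain ⟨m₁, T₁, h₁, φ', hle, h'⟩ := hbody rfl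
      obtain ⟨m₂, T₂, h₂, hT, ht, h''⟩ := ih φ' (by omega) h'
      exact ⟨m₂, _, .loop_true hb h₁ h₂, by omega, ht, h''⟩

/-! ### Rules for single instructions and tests -/

section instructions
variable {m : Store V C} {P : Store V C → ℕ → Prop} {r s t k a : ℕ}

omit [Fintype V] in
theorem Store.exists_setReg_iff {x : ℕ} {R : Store V C → Prop} :
    (∃ m', m.setReg w r x = some m' ∧ R m') ↔
      x < 2 ^ w ∧ R ⟨Function.update m.reg r x, m.mem, m.cur⟩ := by
  simp only [Store.setReg]
  split_ifs with h <;> simp [h]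

@[simp] theorem wp_nop : wp I w S (.instr .nop) m P ↔ P m 1 := by
  simp [wp_instr, Instr.run]

@[simp] theorem wp_const : wp I w S (.instr (.const r a)) m P ↔
    a < 2 ^ w ∧ P ⟨Function.update m.reg r a, m.mem, m.cur⟩ 1 := by
  simp [wp_instr, Instr.run, Store.exists_setReg_iff]

@[simp] theorem wp_copy : wp I w S (.instr (.copy r s)) m P ↔
    m.reg s < 2 ^ w ∧ P ⟨Function.update m.reg r (m.reg s), m.mem, m.cur⟩ 1 := by
  simp [wp_instr, Instr.run, Store.exists_setReg_iff]

@[simp] theorem wp_add : wp I w S (.instr (.add r s t)) m P ↔ m.reg s + m.reg t < 2 ^ w ∧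
    P ⟨Function.update m.reg r (m.reg s + m.reg t), m.mem, m.cur⟩ 1 := by
  simp [wp_instr, Instr.run, Store.exists_setReg_iff]

@[simp] theorem wp_sub : wp I w S (.instr (.sub r s t)) m P ↔ m.reg s - m.reg t < 2 ^ w ∧
    P ⟨Function.update m.reg r (m.reg s - m.reg t), m.mem, m.cur⟩ 1 := by
  simp [wp_instr, Instr.run, Store.exists_setReg_iff]

@[simp] theorem wp_load : wp I w S (.instr (.load r s)) m P ↔
    m.reg s < S ∧ m.mem (m.reg s) < 2 ^ w ∧
      P ⟨Function.update m.reg r (m.mem (m.reg s)), m.mem, m.cur⟩ 1 := by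
  simp only [wp_instr, Instr.run]
  split_ifs with h <;> simp [h, Store.exists_setReg_iff]

@[simp] theorem wp_store : wp I w S (.instr (.store r s)) m P ↔
    m.reg r < S ∧ P ⟨m.reg, Function.update m.mem (m.reg r) (m.reg s), m.cur⟩ 1 := by
  simp only [wp_instr, Instr.run]
  split_ifs with h <;> simp [h]

@[simp] theorem wp_numVertices : wp I w S (.instr (.numVertices r)) m P ↔
    Fintype.card V < 2 ^ w ∧
      P ⟨Function.update m.reg r (Fintype.card V), m.mem, m.cur⟩ 1 := by
  simp [wp_instr, Instr.run, Store.exists_setReg_iff]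

@[simp] theorem wp_numStates : wp I w S (.instr (.numStates r)) m P ↔
    Fintype.card Q < 2 ^ w ∧
      P ⟨Function.update m.reg r (Fintype.card Q), m.mem, m.cur⟩ 1 := by
  simp [wp_instr, Instr.run, Store.exists_setReg_iff]

@[simp] theorem wp_minState : wp I w S (.instr (.minState r)) m P ↔
    I.topNum (Finset.univ : Finset Q).min < 2 ^ w ∧
      P ⟨Function.update m.reg r (I.topNum (Finset.univ : Finset Q).min), m.mem, m.cur⟩ 1 := by
  simp [wp_instr, Instr.run, Store.exists_setReg_iff]

open Classical in
@[simp] theorem wp_isEve : wp I w S (.instr (.isEve r s)) m P ↔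
    ∃ v, I.vertexAt (m.reg s) = some v ∧ (if v ∈ G.eve then 1 else 0) < 2 ^ w ∧
      P ⟨Function.update m.reg r (if v ∈ G.eve then 1 else 0), m.mem, m.cur⟩ 1 := by
  rw [wp_instr, Instr.run]
  cases I.vertexAt (m.reg s) <;> simp [Store.exists_setReg_iff]

@[simp] theorem wp_outList : wp I w S (.instr (.outList k s)) m P ↔
    ∃ v, I.vertexAt (m.reg s) = some v ∧
      P ⟨m.reg, m.mem, Function.update m.cur k (I.outEdges v)⟩ 1 := by
  rw [wp_instr, Instr.run]
  cases I.vertexAt (m.reg s) <;> simp [Store.setCur]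

@[simp] theorem wp_inList : wp I w S (.instr (.inList k s)) m P ↔
    ∃ v, I.vertexAt (m.reg s) = some v ∧
      P ⟨m.reg, m.mem, Function.update m.cur k (I.inEdges v)⟩ 1 := by
  rw [wp_instr, Instr.run]
  cases I.vertexAt (m.reg s) <;> simp [Store.setCur]

@[simp] theorem wp_next : wp I w S (.instr (.next k)) m P ↔ m.cur k ≠ [] ∧
    P ⟨m.reg, m.mem, Function.update m.cur k (m.cur k).tail⟩ 1 := by
  rw [wp_instr, Instr.run]
  cases m.cur k <;> simp [Store.setCur]

@[simp] theorem wp_source : wp I w S (.instr (.source r k)) m P ↔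
    ∃ e, (m.cur k).head? = some e ∧ (I.vertexNum e.1 : ℕ) < 2 ^ w ∧
      P ⟨Function.update m.reg r (I.vertexNum e.1), m.mem, m.cur⟩ 1 := by
  rw [wp_instr, Instr.run]
  cases (m.cur k).head? <;> simp [Store.exists_setReg_iff]

@[simp] theorem wp_target : wp I w S (.instr (.target r k)) m P ↔
    ∃ e, (m.cur k).head? = some e ∧ (I.vertexNum e.2.2 : ℕ) < 2 ^ w ∧
      P ⟨Function.update m.reg r (I.vertexNum e.2.2), m.mem, m.cur⟩ 1 := by
  rw [wp_instr, Instr.run]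
  cases (m.cur k).head? <;> simp [Store.exists_setReg_iff]

@[simp] theorem wp_rho : wp I w S (.instr (.rho r s k)) m P ↔
    ∃ e, (m.cur k).head? = some e ∧ ∃ x, I.stateAt (m.reg s) = some x ∧
      I.topNum (A.rho x e.2.1) < 2 ^ w ∧
      P ⟨Function.update m.reg r (I.topNum (A.rho x e.2.1)), m.mem, m.cur⟩ 1 := by
  rw [wp_instr, Instr.run]
  cases (m.cur k).head? <;> cases I.stateAt (m.reg s) <;> simp [Store.exists_setReg_iff]

@[simp] theorem wp_ite_eq {p q : Prog} : wp I w S (.ite (.eq r s) p q) m P ↔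
    (m.reg r = m.reg s → wp I w S p m fun m' T => P m' (T + 1)) ∧
    (¬ m.reg r = m.reg s → wp I w S q m fun m' T => P m' (T + 1)) := by
  rw [wp_ite rfl]
  simp

@[simp] theorem wp_ite_stateLe {p q : Prog} : wp I w S (.ite (.stateLe r s) p q) m P ↔
    ∃ x, I.stateAt (m.reg r) = some x ∧ ∃ y, I.stateAt (m.reg s) = some y ∧
      (x ≤ y → wp I w S p m fun m' T => P m' (T + 1)) ∧
      (¬ x ≤ y → wp I w S q m fun m' T => P m' (T + 1)) := by
  constructor
  · rintro ⟨m', T, h, hP⟩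
    have hex : ∃ b, Test.eval I m (.stateLe r s) = some b := by
      cases h with
      | ite_true ht h => exact ⟨_, ht⟩
      | ite_false ht h => exact ⟨_, ht⟩
    obtain ⟨b, hb⟩ := hex
    have hb' := hb
    simp only [Test.eval, Option.bind_eq_some_iff, Option.map_eq_some_iff] at hb'
    obtain ⟨x, hx, y, hy, rfl⟩ := hb'
    refine ⟨x, hx, y, hy, ?_⟩
    have := (wp_ite hb).1 ⟨m', T, h, hP⟩
    simpa using this
  · rintro ⟨x, hx, y, hy, h⟩
    rw [wp_ite (b := open Classical in decide (x ≤ y)) (by simp [Test.eval, hx, hy])]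
    simpa using h

end instructions

omit [LinearOrder Q] in
theorem Input.stateAt_topNum (x : WithTop Q) : I.stateAt (I.topNum x) = some x := by
  induction x using WithTop.recTopCoe with
  | top => simp [Input.stateAt, show I.topNum ⊤ = Fintype.card Q from rfl]
  | coe q => simp [Input.stateAt, show I.topNum (q : WithTop Q) = I.stateNum q from rfl]

omit [LinearOrder Q] in
theorem Input.vertexAt_vertexNum (v : V) : I.vertexAt (I.vertexNum v) = some v := by
  simp [Input.vertexAt]

omit [LinearOrder Q] in
theorem Input.topNum_le (x : WithTop Q) : I.topNum x ≤ Fintype.card Q := by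
  induction x using WithTop.recTopCoe with
  | top => exact le_rfl
  | coe q => exact (I.stateNum q).2.le

omit [LinearOrder Q] in
theorem Input.topNum_eq_card_iff (x : WithTop Q) : I.topNum x = Fintype.card Q ↔ x = ⊤ := by
  induction x using WithTop.recTopCoe with
  | top => exact ⟨fun _ => rfl, fun _ => rfl⟩
  | coe q => simpa using (show I.topNum (q : WithTop Q) < _ from (I.stateNum q).2).ne

/-! ### Programs that traverse lists -/

/-- Sequences of instructions. -/
def block : List Instr → Prog
  | [] => .instr .nop
  | i :: l => .seq (.instr i) (block l)

@[simp] theorem wp_block_nil {m : Store V C} {P : Store V C → ℕ → Prop} :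
    wp I w S (block []) m P ↔ P m 1 := wp_nop

@[simp] theorem wp_block_cons {i : Instr} {l : List Instr} {m : Store V C}
    {P : Store V C → ℕ → Prop} : wp I w S (block (i :: l)) m P ↔
      wp I w S (.instr i) m fun m' T => wp I w S (block l) m' fun m'' T' => P m'' (T + T') :=
  wp_seq

/-- Run `p` for the edges of the list at the cursor `0`. -/
def forEdges (p : Prog) : Prog := .loop (.hasEdge 0) (.seq p (.instr (.next 0)))

/-- The invariant `J` speaks of the prefix already traversed. Each edge costs the body, one test and
one `next`; the last `1` is the failing test. -/
theorem wp_forEdges {p : Prog} {m : Store V C} {P : Store V C → ℕ → Prop}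
    {l : List (V × C × V)} (c : ℕ)
    (J : List (V × C × V) → (ℕ → ℕ) → (ℕ → ℕ) → Prop) (hl : m.cur 0 = l) (h0 : J [] m.reg m.mem)
    (hJ : ∀ l₁ e l₂ m, l = l₁ ++ e :: l₂ → m.cur 0 = e :: l₂ → J l₁ m.reg m.mem →
      wp I w S p m fun m' T => T ≤ c ∧ m'.cur 0 = e :: l₂ ∧ J (l₁ ++ [e]) m'.reg m'.mem)
    (hP : ∀ m' T, T ≤ (c + 2) * l.length + 1 → J l m'.reg m'.mem → P m' T) :
    wp I w S (forEdges p) m P := by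
  refine wp_loop (φ := (c + 2) * l.length + 1) (fun φ m => ∃ l₁ l₂, l = l₁ ++ l₂ ∧
    m.cur 0 = l₂ ∧ J l₁ m.reg m.mem ∧ φ = (c + 2) * l₂.length + 1) ⟨[], l, rfl, hl, h0, rfl⟩ ?_ ?_
  · rintro φ m ⟨l₁, l₂, h, hcur, hm, rfl⟩
    refine ⟨!(m.cur 0).isEmpty, rfl, by omega, fun hb => ?_⟩
    cases l₂ with
    | nil => simp [hcur] at hb
    | cons e l₂ =>
      simp only [wp_seq, wp_next]
      refine (hJ l₁ e l₂ m h hcur hm).mono ?_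
      rintro m' T ⟨hT, hcur', hm'⟩
      refine ⟨by simp [hcur'], _, ?_, l₁ ++ [e], l₂, by simp [h], by simp [hcur'], hm', rfl⟩
      simp only [List.length_cons, Nat.mul_add]
      omega
  · rintro φ' m' T hT ⟨l₁, l₂, h, hcur, hm, -⟩ ht
    cases l₂ with
    | nil => simp only [List.append_nil] at h; exact hP m' T hT (h ▸ hm)
    | cons => simp [Test.eval, hcur] at ht

/-- Run `p` for all vertices, with the number of the vertex in register `7`; registers `0` and `4`
contain `|V|` and `1`. -/
def forVertices (p : Prog) : Prog := .seq (.instr (.const 7 0))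
  (.loop (.lt 7 0) (.seq p (.instr (.add 7 7 4))))

/-- Each vertex costs the body, one test and one increment; the final `2` is the initialisation and
the failing test. -/
theorem wp_forVertices {p : Prog} {m : Store V C} {P : Store V C → ℕ → Prop} (c : V → ℕ)
    (J : ℕ → (ℕ → ℕ) → (ℕ → ℕ) → Prop) (hw : Fintype.card V < 2 ^ w)
    (h0 : J 0 (Function.update m.reg 7 0) m.mem)
    (hreg : ∀ i reg mem, J i reg mem → reg 0 = Fintype.card V ∧ reg 4 = 1)
    (hJ : ∀ v m, m.reg 7 = (I.vertexNum v : ℕ) → J (I.vertexNum v) m.reg m.mem →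
      wp I w S p m fun m' T => T ≤ c v ∧ m'.reg 7 = (I.vertexNum v : ℕ) ∧
        J (I.vertexNum v + 1) (Function.update m'.reg 7 (I.vertexNum v + 1)) m'.mem)
    (hP : ∀ m' T, T ≤ ∑ v, (c v + 2) + 2 → J (Fintype.card V) m'.reg m'.mem → P m' T) :
    wp I w S (forVertices p) m P := by
  classical
  simp only [forVertices, wp_seq, wp_const]
  refine ⟨by positivity, ?_⟩
  refine wp_loop (fun φ m => ∃ i, i ≤ Fintype.card V ∧ m.reg 7 = i ∧ J i m.reg m.mem ∧
    φ = ∑ v with i ≤ (I.vertexNum v : ℕ), (c v + 2) + 1)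
    ⟨0, Nat.zero_le _, by simp, h0, rfl⟩ ?_ ?_
  · rintro φ m ⟨i, hi, h7, hm, rfl⟩
    refine ⟨decide (m.reg 7 < m.reg 0), rfl, by omega, fun hb => ?_⟩
    rw [(hreg _ _ _ hm).1, h7, decide_eq_true_iff] at hb
    obtain ⟨v, rfl⟩ : ∃ v, (I.vertexNum v : ℕ) = i := ⟨I.vertexNum.symm ⟨i, hb⟩, by simp⟩
    simp only [wp_seq, wp_add]
    refine (hJ v m h7 hm).mono ?_
    rintro m' T ⟨hT, h7', hm'⟩
    have h4 : m'.reg 4 = 1 := by simpa using (hreg _ _ _ hm').2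
    rw [h7', h4]
    refine ⟨by omega, _, ?_, (I.vertexNum v : ℕ) + 1, hb, by simp, hm', rfl⟩
    -- Passing `v` removes exactly the summand of `v` from the remaining budget.
    have : (Finset.univ.filter fun u => (I.vertexNum v : ℕ) ≤ I.vertexNum u) =
        insert v (Finset.univ.filter fun u => (I.vertexNum v : ℕ) + 1 ≤ I.vertexNum u) := by
      ext u
      simp only [Finset.mem_filter, Finset.mem_univ, true_and, Finset.mem_insert]
      rw [Nat.succ_le_iff, le_iff_eq_or_lt, ← Fin.ext_iff, I.vertexNum.injective.eq_iff,
        eq_comm (a := v)]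
    rw [this, Finset.sum_insert (by simp)]
    omega
  · rintro φ' m' T hT ⟨i, hi, h7, hm, -⟩ ht
    have h : ¬ m'.reg 7 < m'.reg 0 := by simpa [Test.eval] using ht
    rw [(hreg _ _ _ hm).1, h7] at h
    obtain rfl : i = Fintype.card V := by omega
    refine hP _ _ ?_ hm
    simp only [Nat.zero_le, Finset.filter_true] at hT
    omega

end calculus

/-! ### Data representation -/

section representation
variable {V Q C : Type*} [Fintype V] [Fintype Q] {G : Arena V C} {A : ColGraph Q C}

/-- The stack at the address `a` contains the vertices of the list `L`, the head of `L` on top. -/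
def StackRep (I : Input G A) (mem : ℕ → ℕ) (a : ℕ) : List V → Prop
  | [] => True
  | v :: L => mem (a + L.length) = I.vertexNum v ∧ StackRep I mem a L

theorem StackRep.congr {I : Input G A} {mem mem' : ℕ → ℕ} {a : ℕ} : ∀ {L : List V},
    StackRep I mem a L → (∀ i, a ≤ i → i < a + L.length → mem' i = mem i) → StackRep I mem' a L
  | [], _, _ => trivial
  | _ :: _, ⟨h, h'⟩, heq => ⟨(heq _ (by simp) (by simp)).trans h,
      h'.congr fun i hi hi' => heq i hi (by simp; omega)⟩

variable [DecidableEq V]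

/-- The memory consists of the arrays of the values of `μ`, of the supports, and of the marks, and
of a stack. The registers from `0` to `6` contain the addresses of the last three, the address of
the top of the stack, and constants; registers above are for temporary use. -/
structure Rep (I : Input G A) (reg mem : ℕ → ℕ) (μ : V → WithTop Q) (s : V → ℕ) (M : Finset V)
    (L : List V) : Prop where
  reg0 : reg 0 = Fintype.card V
  reg1 : reg 1 = 2 * Fintype.card V
  reg2 : reg 2 = 3 * Fintype.card V
  reg3 : reg 3 = 3 * Fintype.card V + L.length
  reg4 : reg 4 = 1
  reg5 : reg 5 = Fintype.card Q
  reg6 : reg 6 = 0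
  value : ∀ v, mem (I.vertexNum v) = I.topNum (μ v)
  support : ∀ v, mem (Fintype.card V + I.vertexNum v) = s v
  mark : ∀ v, mem (2 * Fintype.card V + I.vertexNum v) = if v ∈ M then 1 else 0
  stack : StackRep I mem (3 * Fintype.card V) L

namespace Rep
variable {I : Input G A} {reg mem : ℕ → ℕ} {μ : V → WithTop Q} {s : V → ℕ} {M : Finset V}
    {L : List V}

@[simp] theorem update_reg_iff {r x : ℕ} (hr : 7 ≤ r) :
    Rep I (Function.update reg r x) mem μ s M L ↔ Rep I reg mem μ s M L := by
  have h : ∀ i, i < 7 → Function.update reg r x i = reg i := fun i hi =>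
    Function.update_of_ne (by omega) _ _
  have h0 := h 0 (by omega)
  have h1 := h 1 (by omega)
  have h2 := h 2 (by omega)
  have h3 := h 3 (by omega)
  have h4 := h 4 (by omega)
  have h5 := h 5 (by omega)
  have h6 := h 6 (by omega)
  constructor
  · rintro ⟨a0, a1, a2, a3, a4, a5, a6, a7, a8, a9, a10⟩
    exact ⟨h0 ▸ a0, h1 ▸ a1, h2 ▸ a2, h3 ▸ a3, h4 ▸ a4, h5 ▸ a5, h6 ▸ a6, a7, a8, a9, a10⟩
  · rintro ⟨a0, a1, a2, a3, a4, a5, a6, a7, a8, a9, a10⟩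
    exact ⟨h0 ▸ a0, h1 ▸ a1, h2 ▸ a2, h3 ▸ a3, h4 ▸ a4, h5 ▸ a5, h6 ▸ a6, a7, a8, a9, a10⟩

/-- The arrays and the stack occupy disjoint address ranges, delimited by the multiples of `|V|` up
to `3 |V|`, so writing to one leaves the others intact. The same holds for the next updates. -/
theorem setValue (h : Rep I reg mem μ s M L) (v : V) (x : WithTop Q) :
    Rep I reg (Function.update mem (I.vertexNum v) (I.topNum x)) (Function.update μ v x) s M L where
  __ := h
  value u := by
    by_cases hu : u = v
    · subst hu; simp
    · have : (I.vertexNum u : ℕ) ≠ I.vertexNum v := by simpa [Fin.val_inj] using hu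
      simp [hu, this, h.value]
  support u := by rw [Function.update_of_ne (by omega), h.support]
  mark u := by rw [Function.update_of_ne (by omega), h.mark]
  stack := h.stack.congr fun i hi _ => Function.update_of_ne (by omega) _ _

theorem setSupport (h : Rep I reg mem μ s M L) (v : V) (x : ℕ) :
    Rep I reg (Function.update mem (Fintype.card V + I.vertexNum v) x) μ (Function.update s v x)
      M L where
  __ := h
  value u := by rw [Function.update_of_ne (by omega), h.value]
  support u := by
    by_cases hu : u = v
    · subst hu; simp
    · have : (I.vertexNum u : ℕ) ≠ I.vertexNum v := by simpa [Fin.val_inj] using hu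
      simp [hu, this, h.support]
  mark u := by rw [Function.update_of_ne (by omega), h.mark]
  stack := h.stack.congr fun i hi _ => Function.update_of_ne (by omega) _ _

theorem insertMark (h : Rep I reg mem μ s M L) (v : V) :
    Rep I reg (Function.update mem (2 * Fintype.card V + I.vertexNum v) 1) μ s (insert v M) L where
  __ := h
  value u := by rw [Function.update_of_ne (by omega), h.value]
  support u := by rw [Function.update_of_ne (by omega), h.support]
  mark u := by
    by_cases hu : u = v
    · subst hu; simp
    · have : (I.vertexNum u : ℕ) ≠ I.vertexNum v := by simpa [Fin.val_inj] using hu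
      simp [hu, this, h.mark]
  stack := h.stack.congr fun i hi _ => Function.update_of_ne (by omega) _ _

theorem eraseMark (h : Rep I reg mem μ s M L) (v : V) :
    Rep I reg (Function.update mem (2 * Fintype.card V + I.vertexNum v) 0) μ s (M.erase v) L where
  __ := h
  value u := by rw [Function.update_of_ne (by omega), h.value]
  support u := by rw [Function.update_of_ne (by omega), h.support]
  mark u := by
    by_cases hu : u = v
    · subst hu; simp
    · have : (I.vertexNum u : ℕ) ≠ I.vertexNum v := by simpa [Fin.val_inj] using hu
      simp [hu, this, h.mark]
  stack := h.stack.congr fun i hi _ => Function.update_of_ne (by omega) _ _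

theorem push (h : Rep I reg mem μ s M L) (v : V) :
    Rep I (Function.update reg 3 (3 * Fintype.card V + L.length + 1))
      (Function.update mem (3 * Fintype.card V + L.length) (I.vertexNum v)) μ s M (v :: L) where
  reg0 := h.reg0
  reg1 := h.reg1
  reg2 := h.reg2
  reg3 := rfl
  reg4 := h.reg4
  reg5 := h.reg5
  reg6 := h.reg6
  value u := by rw [Function.update_of_ne (by omega), h.value]
  support u := by rw [Function.update_of_ne (by omega), h.support]
  mark u := by rw [Function.update_of_ne (by omega), h.mark]
  stack := ⟨Function.update_self .., h.stack.congr fun i hi _ =>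
    Function.update_of_ne (by omega) _ _⟩

theorem pop {v : V} (h : Rep I reg mem μ s M (v :: L)) :
    Rep I (Function.update reg 3 (3 * Fintype.card V + L.length)) mem μ s M L where
  reg0 := h.reg0
  reg1 := h.reg1
  reg2 := h.reg2
  reg3 := rfl
  reg4 := h.reg4
  reg5 := h.reg5
  reg6 := h.reg6
  value := h.value
  support := h.support
  mark := h.mark
  stack := h.stack.2

end Rep

/-- A word can hold all addresses and all numbers of states. -/
structure Fits (I : Input G A) (w : ℕ) : Prop where
  address_lt : 4 * Fintype.card V < 2 ^ w
  state_lt : Fintype.card Q < 2 ^ w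

end representation

/-! ### The program -/

/-- Push the vertex in register `r`. -/
def pushVertex (r : ℕ) : Prog := block [.store 3 r, .add 3 3 4]

/-- Store register `16` as the support of vertex `7`, and push the vertex if this is zero. -/
def storeSupport : Prog :=
  .seq (block [.add 14 0 7, .store 14 16]) <|
  .ite (.eq 16 6) (pushVertex 7) (block [])

/-- Compute the support of vertex `7`, the value of which is in register `9`, store it, and push
the vertex if the support is zero. -/
def updateSupport : Prog :=
  .seq (.instr (.isEve 10 7)) <|
  .seq (.ite (.eq 10 4)
    (.seq (.ite (.eq 9 5) (.instr (.copy 16 4)) (.instr (.copy 16 6))) <|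
     .seq (.instr (.outList 0 7)) <|
     .seq (forEdges (.seq (block [.target 11 0, .add 13 1 11, .load 15 13]) <|
        .ite (.eq 15 6)
          (.seq (block [.load 12 11, .rho 12 12 0]) <|
            .ite (.stateLe 12 9) (block [.store 13 4, .add 16 16 4]) (block []))
          (block []))) <|
     .seq (.instr (.outList 0 7)) <|
     forEdges (block [.target 11 0, .add 13 1 11, .store 13 6]))
    (.seq (block [.copy 16 4, .outList 0 7]) <|
     forEdges (.seq (block [.target 11 0, .load 12 11, .rho 12 12 0]) <|
        .ite (.stateLe 12 9) (block []) (block [.copy 16 6]))))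
  storeSupport

/-- Put the lifted value of vertex `7` into register `9`; its old value is in register `8`. -/
def computeLifted : Prog :=
  .seq (block [.isEve 10 7, .outList 0 7]) <|
  .ite (.eq 10 4)
    (.seq (.instr (.copy 9 5)) <|
     forEdges (.seq (block [.target 11 0, .load 12 11, .rho 12 12 0]) <|
        .ite (.stateLe 12 9) (block [.copy 9 12]) (block [])))
    (.seq (.instr (.copy 9 8)) <|
     forEdges (.seq (block [.target 11 0, .load 12 11, .rho 12 12 0]) <|
        .ite (.stateLe 12 9) (block []) (block [.copy 9 12])))

/-- Mark the predecessors of vertex `7` with an edge that is suitable for the value in `9`. -/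
def markPredecessors : Prog :=
  .seq (.instr (.inList 0 7)) <|
  forEdges (.seq (block [.source 11 0, .load 12 11, .rho 15 9 0]) <|
    .ite (.stateLe 15 12) (block [.add 13 1 11, .store 13 4]) (block []))

/-- The part of `propagate` for a predecessor of Eve: its number is in register `11`, its value in
register `12`, its support in register `16`, and the address of the latter in register `14`. -/
def propagateEve : Prog :=
  .seq (block [.add 13 1 11, .load 15 13]) <|
  .ite (.eq 15 6)
    (.seq (block [.rho 15 8 0]) <|
      .ite (.stateLe 15 12)
        (.seq (block [.store 13 4, .sub 16 16 4, .store 14 16]) <|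
          .ite (.eq 16 6) (pushVertex 11) (block []))
        (block []))
    (block [])

/-- The part of `propagate` for a predecessor of Adam, with the same registers. -/
def propagateAdam : Prog :=
  .ite (.eq 16 6) (block [])
    (.seq (block [.rho 15 9 0]) <|
      .ite (.stateLe 15 12) (block []) (.seq (block [.store 14 6]) (pushVertex 11)))

/-- Adapt the supports of the predecessors of vertex `7` to the change of its value from that in
register `8` to that in register `9`, and push those predecessors whose support becomes zero. -/
def propagate : Prog :=
  .seq (.instr (.inList 0 7)) <|
  forEdges (.seq (block [.source 11 0, .load 12 11, .isEve 10 11, .add 14 0 11, .load 16 14]) <|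
    .ite (.eq 10 4) propagateEve propagateAdam)

/-- Clear the marks of the predecessors of vertex `7`. -/
def clearPredecessors : Prog :=
  .seq (.instr (.inList 0 7)) (forEdges (block [.source 11 0, .add 13 1 11, .store 13 6]))

/-- Lift the vertex on top of the stack. -/
def liftTop : Prog :=
  .seq (block [.sub 3 3 4, .load 7 3, .load 8 7]) <|
  .seq computeLifted <| .seq markPredecessors <| .seq propagate <| .seq clearPredecessors <|
  .seq (.instr (.store 7 9)) updateSupport

/-- Compute the least progress measure, and replace its values by the information whether they are
finite. -/
def solve : Prog :=
  .seq (block [.numVertices 0, .add 1 0 0, .add 2 1 0, .copy 3 2, .const 4 1, .numStates 5,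
    .minState 9]) <|
  .seq (forVertices (.instr (.store 7 9))) <|
  .seq (forVertices updateSupport) <|
  .seq (.loop (.lt 2 3) liftTop) <|
  forVertices (.seq (.instr (.load 8 7)) <|
    .ite (.eq 8 5) (.instr (.store 7 6)) (.instr (.store 7 4)))

/-! ### Correctness and running time -/

section verification
variable {V Q C : Type*} [Fintype V] [Fintype Q] [LinearOrder Q] [DecidableEq V] {G : Arena V C}
  {A : ColGraph Q C} {I : Input G A} {w : ℕ}

namespace Fits

omit [LinearOrder Q] [DecidableEq V] in
theorem topNum_lt (hw : Fits I w) (x : WithTop Q) : I.topNum x < 2 ^ w :=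
  (I.topNum_le x).trans_lt hw.state_lt

omit [LinearOrder Q] [DecidableEq V] in
theorem bounds (hw : Fits I w) (v : V) : (I.vertexNum v : ℕ) < 2 ^ w ∧
    Fintype.card V + I.vertexNum v < 2 ^ w ∧ 2 * Fintype.card V + I.vertexNum v < 2 ^ w ∧
    (I.vertexNum v : ℕ) < 4 * Fintype.card V ∧
    Fintype.card V + I.vertexNum v < 4 * Fintype.card V ∧
    2 * Fintype.card V + I.vertexNum v < 4 * Fintype.card V ∧ 1 < 2 ^ w ∧ 0 < 2 ^ w := by
  have h := (I.vertexNum v).2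
  have h' := hw.address_lt
  omega

end Fits

/-- The loop of `updateSupport` for a vertex of Adam. -/
theorem wp_adamLoop (hw : Fits I w) {m : Store V C} {μ : V → WithTop Q} {s : V → ℕ}
    {M : Finset V} {L : List V} {v : V} (hm : Rep I m.reg m.mem μ s M L)
    (h7 : m.reg 7 = (I.vertexNum v : ℕ)) (h9 : m.reg 9 = I.topNum (μ v)) (h16 : m.reg 16 = 1)
    {l : List (V × C × V)} (hl : m.cur 0 = l) :
    wp I w (4 * Fintype.card V)
      (forEdges (.seq (block [.target 11 0, .load 12 11, .rho 12 12 0]) <|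
        .ite (.stateLe 12 9) (block []) (block [.copy 16 6]))) m fun m' T =>
      T ≤ 20 * l.length + 1 ∧ Rep I m'.reg m'.mem μ s M L ∧ m'.reg 7 = (I.vertexNum v : ℕ) ∧
      m'.reg 9 = I.topNum (μ v) ∧ m'.reg 16 = open Classical in
        if ∀ e ∈ l, A.rho (μ e.2.2) e.2.1 ≤ μ v then 1 else 0 := by
  classical
  refine wp_forEdges 18 (fun l reg mem => Rep I reg mem μ s M L ∧ reg 7 = (I.vertexNum v : ℕ) ∧
    reg 9 = I.topNum (μ v) ∧ reg 16 = if ∀ e ∈ l, A.rho (μ e.2.2) e.2.1 ≤ μ v then 1 else 0) hl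
    ⟨hm, h7, h9, by simp [h16]⟩ ?_ fun m' T hT h => ⟨hT, h⟩
  rintro l₁ e l₂ m - hcur ⟨hm, h7, h9, h16⟩
  have ht := hw.bounds e.2.2
  simp [-Prod.exists, -Prod.forall, hcur, hm, hm.value, I.stateAt_topNum, hw.topNum_lt, ht, hm.reg6, h7, h9, h16]
  constructor
  · intro h
    simp [or_imp, forall_and, h, -Prod.forall]
  · exact fun h => Or.inr h

/-- The counting loop of `updateSupport` for a vertex of Eve. -/
theorem wp_eveLoop (hw : Fits I w) {m : Store V C} {μ : V → WithTop Q} {s : V → ℕ}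
    {L : List V} {v : V} (hm : Rep I m.reg m.mem μ s ∅ L)
    (h7 : m.reg 7 = (I.vertexNum v : ℕ)) (h9 : m.reg 9 = I.topNum (μ v)) {n : ℕ} (hn : n ≤ 1)
    (h16 : m.reg 16 = n)
    {l : List (V × C × V)} (hl : m.cur 0 = l) :
    wp I w (4 * Fintype.card V)
      (forEdges (.seq (block [.target 11 0, .add 13 1 11, .load 15 13]) <|
        .ite (.eq 15 6)
          (.seq (block [.load 12 11, .rho 12 12 0]) <|
            .ite (.stateLe 12 9) (block [.store 13 4, .add 16 16 4]) (block []))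
          (block []))) m fun m' T =>
      T ≤ 20 * l.length + 1 ∧ ∃ M : Finset V,
      (∀ t, t ∈ M ↔ ∃ e ∈ l, e.2.2 = t ∧ A.rho (μ t) e.2.1 ≤ μ v) ∧
      Rep I m'.reg m'.mem μ s M L ∧ m'.reg 7 = (I.vertexNum v : ℕ) ∧
      m'.reg 9 = I.topNum (μ v) ∧ m'.reg 16 = n + M.card := by
  classical
  refine wp_forEdges 18 (fun l reg mem => ∃ M : Finset V,
    (∀ t, t ∈ M ↔ ∃ e ∈ l, e.2.2 = t ∧ A.rho (μ t) e.2.1 ≤ μ v) ∧ Rep I reg mem μ s M L ∧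
    reg 7 = (I.vertexNum v : ℕ) ∧ reg 9 = I.topNum (μ v) ∧ reg 16 = n + M.card) hl
    ⟨∅, by simp, hm, h7, h9, by simp [h16]⟩ ?_ fun m' T hT h => ⟨hT, h⟩
  rintro l₁ e l₂ m - hcur ⟨M, hM, hm, h7, h9, h16⟩
  have ht := hw.bounds e.2.2
  -- The counter cannot overflow because it counts distinct targets, plus at most one for `⊤`.
  have hlt : e.2.2 ∉ M → n + M.card + 1 < 2 ^ w := fun h => by
    have := Finset.card_lt_univ_of_notMem h
    have := hw.address_lt
    omega
  by_cases heM : e.2.2 ∈ M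
  · simp [-Prod.exists, -Prod.forall, hcur, hm, hm.value, hm.mark, I.stateAt_topNum, hw.topNum_lt, ht, hm.reg6, hm.reg1, hm.reg4, h7, h9, h16, heM]
    refine ⟨M, fun t => ?_, hm, rfl⟩
    refine (hM t).trans ⟨Or.inl, ?_⟩
    rintro (h | ⟨rfl, h⟩)
    · exact h
    · exact (hM _).1 heM
  · simp [-Prod.exists, -Prod.forall, hcur, hm.value, hm.mark, I.stateAt_topNum, hw.topNum_lt, ht, hm.reg6, hm.reg1, hm.reg4, h7, h9, h16, heM, hlt]
    constructor
    · intro h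
      refine ⟨insert e.2.2 M, fun t => ?_, hm.insertMark _, ?_⟩
      · rw [Finset.mem_insert, hM, or_comm]
        refine or_congr_right ⟨?_, fun h => h.1.symm⟩
        rintro rfl
        exact ⟨rfl, h⟩
      · rw [Finset.card_insert_of_notMem heM, add_assoc]
    · intro h
      refine ⟨M, fun t => ?_, hm, rfl⟩
      refine (hM t).trans ⟨Or.inl, ?_⟩
      rintro (h' | ⟨rfl, h'⟩)
      · exact h'
      · exact absurd h' h.not_ge

/-- Every vertex still marked has an edge not yet traversed, so no mark survives the whole list. The
instruction `i` stands for `source` or `target`, since marks are cleared on predecessors as well as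
on successors. -/
theorem wp_clearLoop (hw : Fits I w) {i : Instr} {f : V × C × V → V}
    (hi : ∀ m P, wp I w (4 * Fintype.card V) (.instr i) m P ↔
      ∃ e, (m.cur 0).head? = some e ∧ (I.vertexNum (f e) : ℕ) < 2 ^ w ∧
        P ⟨Function.update m.reg 11 (I.vertexNum (f e)), m.mem, m.cur⟩ 1)
    {m : Store V C} {μ : V → WithTop Q} {s : V → ℕ}
    {M : Finset V} {L : List V} (hm : Rep I m.reg m.mem μ s M L) {l : List (V × C × V)}
    (hl : m.cur 0 = l) (hM : ∀ u ∈ M, ∃ e ∈ l, f e = u) :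
    wp I w (4 * Fintype.card V) (forEdges (block [i, .add 13 1 11, .store 13 6])) m fun m' T =>
      T ≤ 20 * l.length + 1 ∧ Rep I m'.reg m'.mem μ s ∅ L ∧
      m'.reg 7 = m.reg 7 ∧ m'.reg 9 = m.reg 9 ∧ m'.reg 16 = m.reg 16 := by
  refine wp_forEdges 18 (fun l' reg mem => ∃ M : Finset V,
    (∀ u ∈ M, ∃ e ∈ l, f e = u ∧ e ∉ l') ∧ Rep I reg mem μ s M L ∧
    reg 7 = m.reg 7 ∧ reg 9 = m.reg 9 ∧ reg 16 = m.reg 16) hl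
    ⟨M, by simpa using hM, hm, rfl, rfl, rfl⟩ ?_ ?_
  · rintro l₁ e l₂ m - hcur ⟨M, hM, hm, h⟩
    have ht := hw.bounds (f e)
    simp [hi, -Prod.exists, -Prod.forall, hcur, ht, hm.reg6, hm.reg1, h]
    refine ⟨M.erase (f e), fun u hu => ?_, hm.eraseMark _⟩
    obtain ⟨hne, hu⟩ := Finset.mem_erase.1 hu
    obtain ⟨a, ha, rfl, hal⟩ := hM u hu
    exact ⟨a, ha, rfl, hal, fun h => hne (h ▸ rfl)⟩
  · rintro m' T hT ⟨M, hM, hm, h⟩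
    obtain rfl : M = ∅ := by
      refine Finset.eq_empty_of_forall_notMem fun u hu => ?_
      obtain ⟨a, ha, -, ha'⟩ := hM u hu
      exact ha' ha
    exact ⟨hT, hm, h⟩

theorem wp_clearPredecessors (hw : Fits I w) {m : Store V C} {μ : V → WithTop Q} {s : V → ℕ}
    {M : Finset V} {L : List V} {v : V} (hm : Rep I m.reg m.mem μ s M L)
    (h7 : m.reg 7 = (I.vertexNum v : ℕ)) (hM : ∀ u ∈ M, ∃ e ∈ I.inEdges v, e.1 = u) :
    wp I w (4 * Fintype.card V) clearPredecessors m fun m' T =>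
      T ≤ 20 * (I.inEdges v).length + 2 ∧ Rep I m'.reg m'.mem μ s ∅ L ∧
      m'.reg 7 = m.reg 7 ∧ m'.reg 9 = m.reg 9 := by
  simp only [clearPredecessors, wp_seq, wp_inList, h7, I.vertexAt_vertexNum, Option.some.injEq,
    exists_eq_left']
  refine (wp_clearLoop hw (fun _ _ => wp_source) (by exact hm) (l := I.inEdges v)
    (by simp) hM).mono ?_
  rintro m' T ⟨hT, hm', h7', h9', -⟩
  exact ⟨by omega, hm', h7' ▸ h7, h9'⟩

theorem wp_pushVertex (hw : Fits I w) {m : Store V C} {μ : V → WithTop Q} {s : V → ℕ}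
    {M : Finset V} {L : List V} {v : V} {r : ℕ} (hm : Rep I m.reg m.mem μ s M L)
    (hL : L.length < Fintype.card V) (hr : m.reg r = (I.vertexNum v : ℕ)) :
    wp I w (4 * Fintype.card V) (pushVertex r) m fun m' T =>
      T ≤ 3 ∧ Rep I m'.reg m'.mem μ s M (v :: L) ∧ m'.cur = m.cur ∧
      ∀ i, 7 ≤ i → m'.reg i = m.reg i := by
  have := hw.address_lt
  have h₁ : 3 * Fintype.card V + L.length < 4 * Fintype.card V := by omega
  have h₂ : 3 * Fintype.card V + L.length + 1 < 2 ^ w := by omega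
  simp [pushVertex, hr, hm.reg3, hm.reg4, h₁, h₂]
  exact ⟨hm.push v, fun i hi => Function.update_of_ne (by omega) _ _⟩

theorem wp_storeSupport (hw : Fits I w) {m : Store V C} {μ : V → WithTop Q} {s : V → ℕ}
    {L : List V} {v : V} {x : ℕ} (hm : Rep I m.reg m.mem μ s ∅ L) (hL : L.length < Fintype.card V)
    (h7 : m.reg 7 = (I.vertexNum v : ℕ)) (h16 : m.reg 16 = x) :
    wp I w (4 * Fintype.card V) storeSupport m fun m' T =>
      T ≤ 8 ∧ Rep I m'.reg m'.mem μ (Function.update s v x) ∅ (if x = 0 then v :: L else L) ∧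
      m'.reg 7 = m.reg 7 ∧ m'.reg 9 = m.reg 9 := by
  have hb := hw.bounds v
  simp [storeSupport, h7, h16, hm.reg0, hm.reg6, hb]
  constructor
  · rintro rfl
    refine (wp_pushVertex hw (v := v) ((Rep.update_reg_iff (by simp)).2 (hm.setSupport v 0)) hL
      (by simp [h7])).mono ?_
    rintro m' T ⟨hT, hm', -, hreg⟩
    exact ⟨by omega, by simpa using hm', by simp [hreg, h7], by simp [hreg]⟩
  · intro h0
    simp only [h0, if_false]
    exact hm.setSupport v x

theorem wp_updateSupport (hw : Fits I w) {m : Store V C} {μ : V → WithTop Q} {s : V → ℕ}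
    {L : List V} {v : V} (hm : Rep I m.reg m.mem μ s ∅ L) (hL : L.length < Fintype.card V)
    (h7 : m.reg 7 = (I.vertexNum v : ℕ)) (h9 : m.reg 9 = I.topNum (μ v)) :
    wp I w (4 * Fintype.card V) updateSupport m fun m' T =>
      T ≤ 40 * (I.outEdges v).length + 20 ∧
      Rep I m'.reg m'.mem μ (Function.update s v (support G A μ v)) ∅
        (if support G A μ v = 0 then v :: L else L) ∧
      m'.reg 7 = (I.vertexNum v : ℕ) ∧ m'.reg 9 = I.topNum (μ v) := by
  classical
  have hb := hw.bounds v
  have hend : ∀ (m' : Store V C) (P : Store V C → ℕ → Prop), Rep I m'.reg m'.mem μ s ∅ L →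
      m'.reg 7 = (I.vertexNum v : ℕ) → m'.reg 9 = I.topNum (μ v) →
      m'.reg 16 = support G A μ v →
      (∀ m'' T', T' ≤ 8 → (Rep I m''.reg m''.mem μ (Function.update s v (support G A μ v)) ∅
          (if support G A μ v = 0 then v :: L else L) ∧
        m''.reg 7 = (I.vertexNum v : ℕ) ∧ m''.reg 9 = I.topNum (μ v)) → P m'' T') →
      wp I w (4 * Fintype.card V) storeSupport m' P := by
    intro m' P hm' h7' h9' h16' hP
    refine (wp_storeSupport hw hm' hL h7' h16').mono ?_
    rintro m'' T' ⟨hT', h, h7'', h9''⟩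
    exact hP _ _ hT' ⟨h, h7''.trans h7', h9''.trans h9'⟩
  by_cases hev : v ∈ G.eve
  · have hout : ∀ M : Finset V,
        (∀ t, t ∈ M ↔ ∃ e ∈ I.outEdges v, e.2.2 = t ∧ A.rho (μ t) e.2.1 ≤ μ v) →
        support G A μ v = (if μ v = ⊤ then 1 else 0) + M.card := by
      intro M hM
      simp only [support, hev, if_true]
      congr 2
      ext t
      simp only [hM, Finset.mem_filter, Finset.mem_univ, true_and, I.mem_outEdges]
      constructor
      · rintro ⟨c, he, hc⟩
        exact ⟨_, ⟨he, rfl⟩, rfl, hc⟩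
      · rintro ⟨⟨_, c, _⟩, ⟨he, rfl⟩, rfl, hc⟩
        exact ⟨c, he, hc⟩
    simp [updateSupport, I.topNum_eq_card_iff, h7, h9, hev, hm.reg4, hm.reg5, hm.reg6, hb,
      I.vertexAt_vertexNum]
    -- The counter starts at `1` if the value is `⊤`, and at `0` otherwise.
    refine ⟨fun htop => (wp_eveLoop hw (v := v) (l := I.outEdges v) (n := 1) (by simpa using hm)
        (by simp [h7]) (by simp [h9]) le_rfl (by simp) (by simp)).mono ?_,
      fun htop => (wp_eveLoop hw (v := v) (l := I.outEdges v) (n := 0) (by simpa using hm)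
        (by simp [h7]) (by simp [h9]) zero_le_one (by simp) (by simp)).mono ?_⟩
    all_goals
      rintro m' T ⟨hT, M, hM, hm', h7', h9', h16'⟩
      refine ⟨v, by rw [h7', I.vertexAt_vertexNum], ?_⟩
      refine (wp_clearLoop hw (fun _ _ => wp_target) (by exact hm') (l := I.outEdges v) (by simp)
        fun t ht => ?_).mono ?_
      · obtain ⟨e, he, het, -⟩ := (hM t).1 ht
        exact ⟨e, he, het⟩
      rintro m'' T' ⟨hT', hm'', h7'', h9'', h16''⟩
      refine hend m'' _ hm'' (h7''.trans h7') (h9''.trans h9') ?_ fun m₃ T₃ hT₃ h => ⟨?_, h⟩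
      · rw [h16'', hout M hM]
        simp [h16', htop]
      · omega
  · have hout : support G A μ v =
        if ∀ e ∈ I.outEdges v, A.rho (μ e.2.2) e.2.1 ≤ μ v then 1 else 0 := by
      simp only [support, hev, if_false]
      congr 1
      simp only [I.mem_outEdges, eq_iff_iff]
      constructor
      · rintro h ⟨_, c, t⟩ ⟨he, rfl⟩
        exact h c t he
      · exact fun h c t he => h _ ⟨he, rfl⟩
    simp [updateSupport, h7, h9, hev, hm.reg4, hb, I.vertexAt_vertexNum]
    refine (wp_adamLoop hw (v := v) (l := I.outEdges v) (by simpa using hm) (by simp [h7])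
      (by simp [h9]) (by simp) (by simp)).mono ?_
    rintro m' T ⟨hT, hm', h7', h9', h16'⟩
    exact hend m' _ hm' h7' h9' (h16'.trans hout.symm) fun m'' T' hT' h => ⟨by omega, h⟩

/-! ### The passes of a single lift -/

theorem wp_computeLifted (hw : Fits I w) {m : Store V C} {μ : V → WithTop Q} {s : V → ℕ}
    {M : Finset V} {L : List V} {v : V} (hm : Rep I m.reg m.mem μ s M L)
    (h7 : m.reg 7 = (I.vertexNum v : ℕ)) (h8 : m.reg 8 = I.topNum (μ v)) :
    wp I w (4 * Fintype.card V) computeLifted m fun m' T =>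
      T ≤ 20 * (I.outEdges v).length + 10 ∧ Rep I m'.reg m'.mem μ s M L ∧
      m'.reg 7 = (I.vertexNum v : ℕ) ∧ m'.reg 8 = I.topNum (μ v) ∧
      m'.reg 9 = I.topNum (I.lifted μ v) := by
  classical
  have hb := hw.bounds v
  by_cases hev : v ∈ G.eve
  · simp [computeLifted, h7, h8, hev, hm.reg4, hm.reg5, hb, I.vertexAt_vertexNum, hw.state_lt]
    -- The fold starts at `⊤`, the number of which is `|Q|`, the content of register `5`.
    refine wp_forEdges 18 (fun l reg mem => Rep I reg mem μ s M L ∧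
      reg 7 = (I.vertexNum v : ℕ) ∧ reg 8 = I.topNum (μ v) ∧ reg 9 =
        I.topNum (l.foldl (fun x e => min (A.rho (μ e.2.2) e.2.1) x) ⊤)) (l := I.outEdges v)
      (by simp) ⟨by simpa using hm, by simp [h7], by simp [h8],
        by simpa using ((I.topNum_eq_card_iff ⊤).2 rfl).symm⟩ ?_ ?_
    · rintro l₁ e l₂ m - hcur ⟨hm, h7, h8, h9⟩
      have ht := hw.bounds e.2.2
      simp [-Prod.exists, -Prod.forall, hcur, hm, hm.value, I.stateAt_topNum, hw.topNum_lt, ht,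
        h7, h8, h9]
      constructor
      · intro h
        rw [min_eq_left h]
      · intro h
        rw [min_eq_right h.le]
    · rintro m' T hT ⟨hm', h7', h8', h9'⟩
      refine ⟨by omega, hm', h7', h8', ?_⟩
      rw [h9', Input.lifted, if_pos hev]
  · simp [computeLifted, h7, h8, hev, hm.reg4, hm.reg5, hb, I.vertexAt_vertexNum, hw.topNum_lt]
    refine wp_forEdges 18 (fun l reg mem => Rep I reg mem μ s M L ∧
      reg 7 = (I.vertexNum v : ℕ) ∧ reg 8 = I.topNum (μ v) ∧ reg 9 =
        I.topNum (l.foldl (fun x e => max (A.rho (μ e.2.2) e.2.1) x) (μ v))) (l := I.outEdges v)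
      (by simp) ⟨by simpa using hm, by simp [h7], by simp [h8], by simp⟩ ?_ ?_
    · rintro l₁ e l₂ m - hcur ⟨hm, h7, h8, h9⟩
      have ht := hw.bounds e.2.2
      simp [-Prod.exists, -Prod.forall, hcur, hm, hm.value, I.stateAt_topNum, hw.topNum_lt, ht,
        h7, h8, h9]
      constructor
      · intro h
        rw [max_eq_right h]
      · intro h
        rw [max_eq_left h.le]
    · rintro m' T hT ⟨hm', h7', h8', h9'⟩
      refine ⟨by omega, hm', h7', h8', ?_⟩
      rw [h9', Input.lifted, if_neg hev]

/-- The marked vertices keep a suitable edge into `v` after the change, so propagation must not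
decrease their supports. -/
theorem wp_markPredecessors (hw : Fits I w) {m : Store V C} {μ : V → WithTop Q} {s : V → ℕ}
    {L : List V} {v : V} {x y : WithTop Q} (hm : Rep I m.reg m.mem μ s ∅ L)
    (h7 : m.reg 7 = (I.vertexNum v : ℕ)) (h8 : m.reg 8 = I.topNum x)
    (h9 : m.reg 9 = I.topNum y) :
    wp I w (4 * Fintype.card V) markPredecessors m fun m' T =>
      T ≤ 20 * (I.inEdges v).length + 2 ∧ ∃ M : Finset V,
      (∀ u, u ∈ M ↔ ∃ e ∈ I.inEdges v, e.1 = u ∧ A.rho y e.2.1 ≤ μ u) ∧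
      Rep I m'.reg m'.mem μ s M L ∧ m'.reg 7 = (I.vertexNum v : ℕ) ∧
      m'.reg 8 = I.topNum x ∧ m'.reg 9 = I.topNum y := by
  simp only [markPredecessors, wp_seq, wp_inList, h7, I.vertexAt_vertexNum, Option.some.injEq,
    exists_eq_left']
  refine wp_forEdges 18 (fun l reg mem => ∃ M : Finset V,
    (∀ u, u ∈ M ↔ ∃ e ∈ l, e.1 = u ∧ A.rho y e.2.1 ≤ μ u) ∧ Rep I reg mem μ s M L ∧
    reg 7 = (I.vertexNum v : ℕ) ∧ reg 8 = I.topNum x ∧ reg 9 = I.topNum y)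
    (l := I.inEdges v) (by simp) ⟨∅, by simp, hm, h7, h8, h9⟩ ?_
    fun m' T hT h => ⟨by omega, h⟩
  rintro l₁ e l₂ m - hcur ⟨M, hM, hm, h7, h8, h9⟩
  have ht := hw.bounds e.1
  simp [-Prod.exists, -Prod.forall, hcur, hm.value, I.stateAt_topNum, hw.topNum_lt, ht,
    hm.reg1, hm.reg4, h7, h8, h9]
  constructor
  · intro h
    refine ⟨insert e.1 M, fun u => ?_, hm.insertMark _⟩
    rw [Finset.mem_insert, hM, or_comm]
    refine or_congr_right ⟨?_, fun h => h.1.symm⟩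
    rintro rfl
    exact ⟨rfl, h⟩
  · intro h
    refine ⟨M, fun u => (hM u).trans ⟨Or.inl, ?_⟩, hm⟩
    rintro (h' | ⟨rfl, h'⟩)
    · exact h'
    · exact absurd h' h.not_ge

/-- The state of the supports and of the stack after the edges of the list `l` into `v` have been
considered, if the value of `v` changes from `x` to `y`. -/
structure Propagated (G : Arena V C) (A : ColGraph Q C) (μ : V → WithTop Q) (s : V → ℕ) (v : V)
    (x y : WithTop Q) (M : Finset V) (l : List (V × C × V)) (s' : V → ℕ) (M' : Finset V)
    (L' : List V) : Prop where
  mark : ∀ u ∈ G.eve, u ∈ M' ↔ u ∈ M ∨ ∃ e ∈ l, e.1 = u ∧ A.rho x e.2.1 ≤ μ u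
  mark_of_not_eve : ∀ u ∉ G.eve, u ∈ M' ↔ u ∈ M
  eve : ∀ u ∈ G.eve, s u = s' u + open Classical in
    if u ∉ M ∧ ∃ e ∈ l, e.1 = u ∧ A.rho x e.2.1 ≤ μ u then 1 else 0
  adam : ∀ u ∉ G.eve, s' u = open Classical in
    if ∃ e ∈ l, e.1 = u ∧ ¬ A.rho y e.2.1 ≤ μ u then 0 else s u
  nodup : L'.Nodup
  stack : ∀ u, u ∈ L' ↔ s' u = 0 ∧ u ≠ v

namespace Propagated
variable {μ : V → WithTop Q} {s s' : V → ℕ} {v : V} {x y : WithTop Q} {M M' : Finset V}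
  {l : List (V × C × V)} {L' : List V} {e : V × C × V}

/-- The vertex `v` being lifted is not on the duplicate-free stack, so there is room for one more
entry. -/
theorem length_lt (hp : Propagated G A μ s v x y M l s' M' L') : L'.length < Fintype.card V := by
  have hv : v ∉ L' := fun h => ((hp.stack v).1 h).2 rfl
  exact (List.nodup_cons.2 ⟨hv, hp.nodup⟩).length_le_card

omit [Fintype V] [DecidableEq V] in
theorem exists_mem_append_iff {p : V × C × V → V → Prop} {u : V} :
    (∃ a ∈ l ++ [e], a.1 = u ∧ p a u) ↔ (∃ a ∈ l, a.1 = u ∧ p a u) ∨ e.1 = u ∧ p e u := by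
  simp only [List.mem_append, List.mem_singleton, or_and_right, exists_or, exists_eq_left]

-- A mark means that `v` survives as a target or that its loss is already recorded; an edge
-- unsuitable for the old value never counted.
omit [Fintype V] in
theorem skip_eve (hp : Propagated G A μ s v x y M l s' M' L') (he : e.1 ∈ G.eve)
    (h : e.1 ∉ M' → ¬ A.rho x e.2.1 ≤ μ e.1) : Propagated G A μ s v x y M (l ++ [e]) s' M' L' := by
  classical
  have key : ∀ u ∈ G.eve, (u ∈ M ∨ ∃ a ∈ l ++ [e], a.1 = u ∧ A.rho x a.2.1 ≤ μ u) ↔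
      (u ∈ M ∨ ∃ a ∈ l, a.1 = u ∧ A.rho x a.2.1 ≤ μ u) := by
    intro u hu
    rw [exists_mem_append_iff (p := fun a u => A.rho x a.2.1 ≤ μ u), ← or_assoc,
      or_iff_left_iff_imp]
    rintro ⟨rfl, hc⟩
    by_contra hn
    exact h (fun hM => hn ((hp.mark _ he).1 hM)) hc
  refine ⟨fun u hu => (hp.mark u hu).trans (key u hu).symm, hp.mark_of_not_eve, fun u hu => ?_,
    fun u hu => ?_, hp.nodup, hp.stack⟩
  · rw [hp.eve u hu]
    congr 2
    have := key u hu
    rw [eq_iff_iff]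
    refine and_congr_right fun hM => ?_
    rw [or_iff_right hM, or_iff_right hM] at this
    exact this.symm
  · rw [hp.adam u hu]
    congr 1
    have hne : e.1 ≠ u := fun h => hu (h ▸ he)
    simp only [exists_mem_append_iff (p := fun a u => ¬ A.rho y a.2.1 ≤ μ u), hne, false_and,
      or_false]

-- An Adam support that is already zero, or an edge that still satisfies its condition, needs no
-- change.
omit [Fintype V] in
theorem skip_adam (hp : Propagated G A μ s v x y M l s' M' L') (he : e.1 ∉ G.eve)
    (h : s' e.1 ≠ 0 → A.rho y e.2.1 ≤ μ e.1) :
    Propagated G A μ s v x y M (l ++ [e]) s' M' L' := by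
  classical
  have key : ∀ u ∈ G.eve, (∃ a ∈ l ++ [e], a.1 = u ∧ A.rho x a.2.1 ≤ μ u) ↔
      (∃ a ∈ l, a.1 = u ∧ A.rho x a.2.1 ≤ μ u) := by
    intro u hu
    rw [exists_mem_append_iff (p := fun a u => A.rho x a.2.1 ≤ μ u), or_iff_left_iff_imp]
    rintro ⟨rfl, -⟩
    exact absurd hu he
  refine ⟨fun u hu => by rw [hp.mark u hu, key u hu], hp.mark_of_not_eve, fun u hu => ?_,
    fun u hu => ?_, hp.nodup, hp.stack⟩
  · simp only [hp.eve u hu, key u hu]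
  · have h' := hp.adam u hu
    simp only [exists_mem_append_iff (p := fun a u => ¬ A.rho y a.2.1 ≤ μ u)]
    by_cases hl : ∃ a ∈ l, a.1 = u ∧ ¬ A.rho y a.2.1 ≤ μ u
    · rw [if_pos hl] at h'
      rw [h', if_pos (Or.inl hl)]
    · rw [if_neg hl] at h'
      split_ifs with hc
      · obtain ⟨rfl, hc⟩ := hc.resolve_left hl
        by_contra h0
        exact hc (h h0)
      · exact h'

-- The first suitable edge found from an unmarked Eve vertex records the loss of the target `v`; the
-- new mark prevents parallel edges from recording it again.
omit [Fintype V] in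
theorem step_eve (hp : Propagated G A μ s v x y M l s' M' L') (he : e.1 ∈ G.eve)
    (hv : s v = 0) (hM : e.1 ∉ M') (hx : A.rho x e.2.1 ≤ μ e.1) (hs : s e.1 ≠ 0) :
    Propagated G A μ s v x y M (l ++ [e]) (Function.update s' e.1 (s' e.1 - 1)) (insert e.1 M')
      (if s' e.1 - 1 = 0 then e.1 :: L' else L') := by
  classical
  have hev : e.1 ≠ v := fun h => hs (h ▸ hv)
  have hn := mt (hp.mark _ he).2 hM
  rw [not_or] at hn
  -- Being unmarked, `e.1` has not been decremented, so its support is nonzero and the truncated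
  -- subtraction is exact.
  have hse : s e.1 = s' e.1 := by
    rw [hp.eve _ he, if_neg (fun h => hn.2 h.2), add_zero]
  have heL : e.1 ∉ L' := fun h => hs (hse.trans ((hp.stack _).1 h).1)
  have hap := fun u => exists_mem_append_iff (l := l) (e := e) (u := u)
    (p := fun a u => A.rho x a.2.1 ≤ μ u)
  refine ⟨fun u hu => ?_, fun u hu => ?_, fun u hu => ?_, fun u hu => ?_, ?_, fun u => ?_⟩
  · rw [Finset.mem_insert, hp.mark u hu, hap]
    constructor
    · rintro (rfl | h | h)
      · exact Or.inr (Or.inr ⟨rfl, hx⟩)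
      · exact Or.inl h
      · exact Or.inr (Or.inl h)
    · rintro (h | h | ⟨rfl, -⟩)
      · exact Or.inr (Or.inl h)
      · exact Or.inr (Or.inr h)
      · exact Or.inl rfl
  · rw [Finset.mem_insert, hp.mark_of_not_eve u hu]
    exact or_iff_right fun h => hu (h ▸ he)
  · by_cases hue : u = e.1
    · subst hue
      rw [Function.update_self, if_pos ⟨hn.1, (hap _).2 (Or.inr ⟨rfl, hx⟩)⟩]
      omega
    · rw [Function.update_of_ne hue, hp.eve u hu]
      simp only [hap, Ne.symm hue, false_and, or_false]
  · have hue : u ≠ e.1 := fun h => hu (h ▸ he)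
    rw [Function.update_of_ne hue, hp.adam u hu]
    simp only [exists_mem_append_iff (p := fun a u => ¬ A.rho y a.2.1 ≤ μ u), Ne.symm hue,
      false_and, or_false]
  · split_ifs
    · exact List.nodup_cons.2 ⟨heL, hp.nodup⟩
    · exact hp.nodup
  · by_cases hue : u = e.1
    · subst hue
      split_ifs with h <;> simp [h, hev, heL]
    · rw [Function.update_of_ne hue, ← hp.stack u]
      split_ifs <;> simp [hue]

-- A nonzero support implies that the source is neither on the stack nor equal to `v`, so pushing it
-- creates no duplicate.
omit [Fintype V] in
theorem step_adam (hp : Propagated G A μ s v x y M l s' M' L') (he : e.1 ∉ G.eve)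
    (hv : s v = 0) (hs : s' e.1 ≠ 0) (hy : ¬ A.rho y e.2.1 ≤ μ e.1) :
    Propagated G A μ s v x y M (l ++ [e]) (Function.update s' e.1 0) M' (e.1 :: L') := by
  classical
  have hev : e.1 ≠ v := by
    intro h
    refine hs ?_
    rw [hp.adam _ he, h, hv, ite_self]
  have heL : e.1 ∉ L' := fun h => hs ((hp.stack _).1 h).1
  refine ⟨fun u hu => ?_, hp.mark_of_not_eve, fun u hu => ?_, fun u hu => ?_,
    List.nodup_cons.2 ⟨heL, hp.nodup⟩, fun u => ?_⟩
  · have hue : e.1 ≠ u := fun h => he (h ▸ hu)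
    simp only [exists_mem_append_iff (p := fun a u => A.rho x a.2.1 ≤ μ u), hue, false_and,
      or_false, hp.mark u hu]
  · have hue : e.1 ≠ u := fun h => he (h ▸ hu)
    rw [Function.update_of_ne hue.symm, hp.eve u hu]
    simp only [exists_mem_append_iff (p := fun a u => A.rho x a.2.1 ≤ μ u), hue, false_and,
      or_false]
  · by_cases hue : u = e.1
    · subst hue
      rw [Function.update_self, if_pos ⟨e, by simp, rfl, hy⟩]
    · rw [Function.update_of_ne hue, hp.adam u hu]
      simp only [exists_mem_append_iff (p := fun a u => ¬ A.rho y a.2.1 ≤ μ u), Ne.symm hue,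
        false_and, or_false]
  · by_cases hue : u = e.1
    · subst hue
      simp [hev]
    · rw [Function.update_of_ne hue, ← hp.stack u]
      simp [hue]

end Propagated

theorem wp_propagateEve (hw : Fits I w) {m : Store V C} {μ : V → WithTop Q} {s s' : V → ℕ}
    {M M' : Finset V} {l l₂ : List (V × C × V)} {L' : List V} {e : V × C × V} {v : V}
    {x y : WithTop Q} (hm : Rep I m.reg m.mem μ s' M' L')
    (hp : Propagated G A μ s v x y M l s' M' L') (hev : e.1 ∈ G.eve) (hv : s v = 0)
    (hpos : A.rho x e.2.1 ≤ μ e.1 → s e.1 ≠ 0) (hs' : s' e.1 < 2 ^ w) (hcur : m.cur 0 = e :: l₂)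
    (h7 : m.reg 7 = (I.vertexNum v : ℕ)) (h8 : m.reg 8 = I.topNum x)
    (h9 : m.reg 9 = I.topNum y) (h11 : m.reg 11 = (I.vertexNum e.1 : ℕ))
    (h12 : m.reg 12 = I.topNum (μ e.1)) (h16 : m.reg 16 = s' e.1)
    (h14 : m.reg 14 = Fintype.card V + I.vertexNum e.1) :
    wp I w (4 * Fintype.card V) propagateEve m fun m' T => T ≤ 18 ∧ m'.cur 0 = e :: l₂ ∧
      ∃ s' M' L', Propagated G A μ s v x y M (l ++ [e]) s' M' L' ∧
      Rep I m'.reg m'.mem μ s' M' L' ∧ m'.reg 7 = (I.vertexNum v : ℕ) ∧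
      m'.reg 8 = I.topNum x ∧ m'.reg 9 = I.topNum y := by
  have ht := hw.bounds e.1
  by_cases heM : e.1 ∈ M'
  · simp [-Prod.exists, -Prod.forall, propagateEve, hcur, hm.reg1, hm.reg6, hm.mark, heM, h11, ht, h7, h8, h9]
    exact ⟨s', M', L', hp.skip_eve hev (absurd heM), hm⟩
  by_cases hx : A.rho x e.2.1 ≤ μ e.1
  · simp [-Prod.exists, -Prod.forall, propagateEve, hcur, hm.reg1, hm.reg4, hm.reg6, hm.mark, heM, h11, ht, h7, h8, h9, I.stateAt_topNum, h12, hx,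
      hw.topNum_lt, h16, (Nat.sub_le _ _).trans_lt hs', h14]
    have hp' := hp.step_eve hev hv heM hx (hpos hx)
    have hm' := (hm.insertMark e.1).setSupport e.1 (s' e.1 - 1)
    constructor
    · intro h0
      rw [if_pos h0] at hp'
      refine (wp_pushVertex hw (v := e.1) (by simpa using hm') hp.length_lt (by simp [h11])).mono ?_
      rintro m' T ⟨hT, h, hc, hreg⟩
      exact ⟨by omega, by rw [hc, hcur], _, _, _, hp', h, by simp [hreg, h7], by simp [hreg, h8],
        by simp [hreg, h9]⟩
    · intro h0
      rw [if_neg h0] at hp'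
      exact ⟨_, _, _, hp', hm'⟩
  · simp [-Prod.exists, -Prod.forall, propagateEve, hcur, hm.reg1, hm.reg6, hm.mark, heM, h11, ht, h7, h8, h9, I.stateAt_topNum, h12, hx,
      hw.topNum_lt]
    exact fun _ => ⟨s', M', L', hp.skip_eve hev fun _ => hx, hm⟩

theorem wp_propagateAdam (hw : Fits I w) {m : Store V C} {μ : V → WithTop Q} {s s' : V → ℕ}
    {M M' : Finset V} {l l₂ : List (V × C × V)} {L' : List V} {e : V × C × V} {v : V}
    {x y : WithTop Q} (hm : Rep I m.reg m.mem μ s' M' L')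
    (hp : Propagated G A μ s v x y M l s' M' L') (hev : e.1 ∉ G.eve) (hv : s v = 0)
    (hcur : m.cur 0 = e :: l₂)
    (h7 : m.reg 7 = (I.vertexNum v : ℕ)) (h8 : m.reg 8 = I.topNum x)
    (h9 : m.reg 9 = I.topNum y) (h11 : m.reg 11 = (I.vertexNum e.1 : ℕ))
    (h12 : m.reg 12 = I.topNum (μ e.1)) (h16 : m.reg 16 = s' e.1)
    (h14 : m.reg 14 = Fintype.card V + I.vertexNum e.1) :
    wp I w (4 * Fintype.card V) propagateAdam m fun m' T => T ≤ 18 ∧ m'.cur 0 = e :: l₂ ∧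
      ∃ s' M' L', Propagated G A μ s v x y M (l ++ [e]) s' M' L' ∧
      Rep I m'.reg m'.mem μ s' M' L' ∧ m'.reg 7 = (I.vertexNum v : ℕ) ∧
      m'.reg 8 = I.topNum x ∧ m'.reg 9 = I.topNum y := by
  have ht := hw.bounds e.1
  by_cases h0 : s' e.1 = 0
  · simp [-Prod.exists, -Prod.forall, propagateAdam, hcur, hm.reg6, h16, h0, h7, h8, h9]
    exact ⟨s', M', L', hp.skip_adam hev (absurd h0), hm⟩
  · simp [-Prod.exists, -Prod.forall, propagateAdam, hcur, hm.reg6, h16, h0, h7, h8, h9, h12, I.stateAt_topNum, hw.topNum_lt, h14, ht]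
    refine ⟨fun hy => ⟨s', M', L', hp.skip_adam hev fun _ => hy, hm⟩, fun hy => ?_⟩
    refine (wp_pushVertex hw (v := e.1) (by simpa using hm.setSupport e.1 0) hp.length_lt
      (by simp [h11])).mono ?_
    rintro m' T ⟨hT, h, hc, hreg⟩
    exact ⟨by omega, by rw [hc, hcur], _, _, _, hp.step_adam hev hv h0 hy.not_ge, h,
      by simp [hreg, h7], by simp [hreg, h8], by simp [hreg, h9]⟩

theorem wp_propagate (hw : Fits I w) {m : Store V C} {μ : V → WithTop Q} {s : V → ℕ}
    {M : Finset V} {L : List V} {v : V} {x y : WithTop Q} (hm : Rep I m.reg m.mem μ s M L)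
    (h7 : m.reg 7 = (I.vertexNum v : ℕ)) (h8 : m.reg 8 = I.topNum x)
    (h9 : m.reg 9 = I.topNum y) (hL : L.Nodup) (hLs : ∀ u, u ∈ L ↔ s u = 0 ∧ u ≠ v)
    (hv : s v = 0) (hs : ∀ u, s u < 2 ^ w)
    (hpos : ∀ e ∈ I.inEdges v, e.1 ∈ G.eve → A.rho x e.2.1 ≤ μ e.1 → s e.1 ≠ 0) :
    wp I w (4 * Fintype.card V) propagate m fun m' T =>
      T ≤ 30 * (I.inEdges v).length + 2 ∧ ∃ s' M' L',
      Propagated G A μ s v x y M (I.inEdges v) s' M' L' ∧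
      Rep I m'.reg m'.mem μ s' M' L' ∧ m'.reg 7 = (I.vertexNum v : ℕ) ∧
      m'.reg 8 = I.topNum x ∧ m'.reg 9 = I.topNum y := by
  classical
  simp only [propagate, wp_seq, wp_inList, h7, I.vertexAt_vertexNum, Option.some.injEq,
    exists_eq_left']
  refine wp_forEdges 28 (fun l reg mem => ∃ s' M' L',
    Propagated G A μ s v x y M l s' M' L' ∧ Rep I reg mem μ s' M' L' ∧
    reg 7 = (I.vertexNum v : ℕ) ∧ reg 8 = I.topNum x ∧ reg 9 = I.topNum y)
    (l := I.inEdges v) (by simp) ⟨s, M, L, ⟨by simp, by simp, by simp, by simp, hL, hLs⟩,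
      hm, h7, h8, h9⟩ ?_ fun m' T hT h => ⟨by omega, h⟩
  rintro l₁ e l₂ m hl hcur ⟨s', M', L', hp, hm, h7, h8, h9⟩
  have ht := hw.bounds e.1
  have hmem : e ∈ I.inEdges v := by simp [hl]
  by_cases hev : e.1 ∈ G.eve
  · have hs' : s' e.1 < 2 ^ w := by
      have := hp.eve e.1 hev
      have := hs e.1
      omega
    simp [-Prod.exists, -Prod.forall, hcur, hm.value, hm.support, I.vertexAt_vertexNum,
      hw.topNum_lt, ht, hm.reg0, hm.reg4, hs', hev]
    refine (wp_propagateEve hw (by simpa using hm) hp hev hv (hpos e hmem hev) hs' (by simpa using hcur) (by simp [h7])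
      (by simp [h8]) (by simp [h9]) (by simp) (by simp) (by simp) (by simp)).mono ?_
    rintro m' T ⟨hT, h⟩
    exact ⟨by omega, h⟩
  · have hs' : s' e.1 < 2 ^ w := by
      rw [hp.adam e.1 hev]
      split_ifs
      · exact ht.2.2.2.2.2.2.2
      · exact hs _
    simp [-Prod.exists, -Prod.forall, hcur, hm.value, hm.support, I.vertexAt_vertexNum,
      hw.topNum_lt, ht, hm.reg0, hm.reg4, hs', hev]
    refine (wp_propagateAdam hw (by simpa using hm) hp hev hv (by simpa using hcur) (by simp [h7])
      (by simp [h8]) (by simp [h9]) (by simp) (by simp) (by simp) (by simp)).mono ?_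
    rintro m' T ⟨hT, h⟩
    exact ⟨by omega, h⟩

omit [DecidableEq V] in
theorem Fits.support_lt (hw : Fits I w) (μ : V → WithTop Q) (v : V) :
    support G A μ v < 2 ^ w := by
  classical
  have h := Finset.card_le_univ
    (Finset.univ.filter fun t => ∃ c, (v, c, t) ∈ G.edges ∧ A.rho (μ t) c ≤ μ v)
  have hN := hw.address_lt
  have hpos := Fintype.card_pos_iff.2 ⟨v⟩
  simp only [support]
  split_ifs <;> omega

/-- With the marks set for the new value, an Eve support drops exactly when `v` was a suitable
target and is one no longer, which matches `support_update_of_eve`; Adam's case matches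
`support_update_of_not_eve`. -/
theorem Propagated.eq_support (hA : A.IsLinear) {μ : V → WithTop Q} {v : V} {y : WithTop Q}
    (hy : μ v ≤ y) {M M' : Finset V} {s' : V → ℕ} {L' : List V}
    (hp : Propagated G A μ (support G A μ) v (μ v) y M (I.inEdges v) s' M' L')
    (hM : ∀ u, u ∈ M ↔ ∃ e ∈ I.inEdges v, e.1 = u ∧ A.rho y e.2.1 ≤ μ u) {u : V} (huv : u ≠ v) :
    s' u = support G A (Function.update μ v y) u := by
  classical
  have hin : ∀ p : C → Prop, (∃ e ∈ I.inEdges v, e.1 = u ∧ p e.2.1) ↔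
      ∃ c, (u, c, v) ∈ G.edges ∧ p c := by
    intro p
    simp only [I.mem_inEdges]
    constructor
    · rintro ⟨⟨_, c, _⟩, ⟨he, rfl⟩, rfl, hc⟩
      exact ⟨c, he, hc⟩
    · rintro ⟨c, he, hc⟩
      exact ⟨_, ⟨he, rfl⟩, rfl, hc⟩
  by_cases hu : u ∈ G.eve
  · have h := hp.eve u hu
    rw [support_update_of_eve hA hy huv hu] at h
    simp only [hM, hin fun c => A.rho y c ≤ μ u, hin fun c => A.rho (μ v) c ≤ μ u] at h
    split_ifs at h with h₁ h₂ h₂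
    · omega
    · exact absurd h₁.symm h₂
    · exact absurd h₂.symm h₁
    · omega
  · rw [hp.adam u hu, support_update_of_not_eve hA hy huv hu]
    simp only [hin fun c => ¬ A.rho y c ≤ μ u]

/-- Only `v` and its predecessors change support, and each pass runs through one edge list of `v`;
hence the cost is proportional to the weight. -/
theorem wp_liftTop (hA : A.IsLinear) (hw : Fits I w) {m : Store V C} {μ : V → WithTop Q}
    {L : List V} {v : V} (hm : Rep I m.reg m.mem μ (support G A μ) ∅ (v :: L))
    (hL : (v :: L).Nodup) (hLs : ∀ u, u ∈ v :: L ↔ support G A μ u = 0) :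
    wp I w (4 * Fintype.card V) liftTop m fun m' T => T ≤ 100 * I.weight v ∧ ∃ L' : List V,
      L'.Nodup ∧ (∀ u, u ∈ L' ↔
        support G A (Function.update μ v (I.lifted μ v)) u = 0) ∧
      Rep I m'.reg m'.mem (Function.update μ v (I.lifted μ v))
        (support G A (Function.update μ v (I.lifted μ v))) ∅ L' := by
  classical
  have hb := hw.bounds v
  have hv : support G A μ v = 0 := (hLs v).1 List.mem_cons_self
  have hst := support_eq_zero_iff.1 hv
  have hlt := I.lt_lifted hst
  obtain ⟨hvL, hLn⟩ := List.nodup_cons.1 hL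
  have hlen : L.length < Fintype.card V := hL.length_le_card
  have h₁ : 3 * Fintype.card V + L.length < 4 * Fintype.card V := by omega
  have h₂ : 3 * Fintype.card V + L.length < 2 ^ w := h₁.trans hw.address_lt
  have hr3 : m.reg 3 - 1 = 3 * Fintype.card V + L.length := by simp [hm.reg3]
  have htop := hm.stack.1
  simp only [liftTop, wp_seq]
  simp [hr3, hm.reg4, htop, hm.value, h₁, h₂, hb, hw.topNum_lt]
  refine (wp_computeLifted hw (v := v) (by simpa using hm.pop) (by simp) (by simp)).mono ?_
  rintro m₁ T₁ ⟨hT₁, hm₁, h7, h8, h9⟩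
  refine (wp_markPredecessors hw hm₁ h7 h8 h9).mono ?_
  rintro m₂ T₂ ⟨hT₂, M, hM, hm₂, h7, h8, h9⟩
  refine (wp_propagate hw hm₂ h7 h8 h9 hLn (fun u => ?_) hv (hw.support_lt μ)
    fun e he hev hok h0 => ?_).mono ?_
  · rw [← hLs, List.mem_cons]
    constructor
    · exact fun h => ⟨Or.inr h, fun huv => hvL (huv ▸ h)⟩
    · exact fun h => h.1.resolve_left h.2
  · obtain ⟨u, c, t⟩ := e
    obtain ⟨heG, hev'⟩ := (I.mem_inEdges _ _).1 he
    obtain rfl : t = v := hev'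
    -- An Eve predecessor with an edge suitable for the old value is stable, so its support is
    -- nonzero before propagation.
    exact support_eq_zero_iff.1 h0 ⟨fun _ => Or.inr ⟨c, t, heG, hok⟩, absurd hev⟩
  rintro m₃ T₃ ⟨hT₃, s', M', L', hp, hm₃, h7, h8, h9⟩
  refine (wp_clearPredecessors hw hm₃ h7 fun u hu => ?_).mono ?_
  · have hMM : u ∈ M → ∃ e ∈ I.inEdges v, e.1 = u := fun h => by
      obtain ⟨e, he, heu, -⟩ := (hM u).1 h
      exact ⟨e, he, heu⟩
    by_cases hev : u ∈ G.eve
    · obtain h | ⟨e, he, heu, -⟩ := (hp.mark u hev).1 hu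
      · exact hMM h
      · exact ⟨e, he, heu⟩
    · exact hMM ((hp.mark_of_not_eve u hev).1 hu)
  rintro m₄ T₄ ⟨hT₄, hm₄, h7', h9'⟩
  rw [h7] at h7'
  rw [h9] at h9'
  refine ⟨by simp [h7', hb], ?_⟩
  -- The new value is stored only after the passes over predecessors. The support of `v` is then
  -- recomputed from scratch, which also takes care of self-loops.
  refine (wp_updateSupport hw (v := v) (μ := Function.update μ v (I.lifted μ v))
    (by rw [h7', h9']; exact hm₄.setValue v (I.lifted μ v))
    hp.length_lt (by exact h7') (by simp [h9'])).mono ?_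
  rintro m₅ T₅ ⟨hT₅, hm₅, -, -⟩
  have hs' : Function.update s' v (support G A (Function.update μ v (I.lifted μ v)) v) =
      support G A (Function.update μ v (I.lifted μ v)) := by
    funext u
    by_cases hu : u = v
    · subst hu; simp
    · rw [Function.update_of_ne hu]
      exact hp.eq_support hA hlt.le hM hu
  rw [hs'] at hm₅
  have hvL' : v ∉ L' := fun h => ((hp.stack v).1 h).2 rfl
  refine ⟨by simp only [Input.weight]; omega, _, ?_, fun u => ?_, hm₅⟩
  · split_ifs
    · exact List.nodup_cons.2 ⟨hvL', hp.nodup⟩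
    · exact hp.nodup
  · by_cases hu : u = v
    · subst hu
      split_ifs with h <;> simp [h, hvL']
    · rw [← hp.eq_support hA hlt.le hM hu]
      have := hp.stack u
      split_ifs <;> simp [hu, this]

/-- The measure stays below every progress measure and the stack lists exactly the unstable
vertices. Once the stack is empty, the measure is itself a progress measure, hence the least. -/
theorem wp_loop_liftTop (hA : A.IsLinear) (hw : Fits I w) {m : Store V C} {μ₀ : V → WithTop Q}
    {L₀ : List V} (hm : Rep I m.reg m.mem μ₀ (support G A μ₀) ∅ L₀)
    (hL : L₀.Nodup) (hLs : ∀ u, u ∈ L₀ ↔ support G A μ₀ u = 0)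
    (hμ₀ : ∀ ν : V → WithTop Q, (∀ v, StableAt G A ν v) → μ₀ ≤ ν) :
    wp I w (4 * Fintype.card V) (.loop (.lt 2 3) liftTop) m fun m' T =>
      T ≤ 101 * ∑ v, I.potential (μ₀ v) v + 1 ∧ ∃ μ : V → WithTop Q, (∀ v, StableAt G A μ v) ∧
      (∀ ν : V → WithTop Q, (∀ v, StableAt G A ν v) → μ ≤ ν) ∧
      Rep I m'.reg m'.mem μ (support G A μ) ∅ [] := by
  refine wp_loop (φ := 101 * ∑ v, I.potential (μ₀ v) v + 1) (fun φ m => ∃ μ L,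
    Rep I m.reg m.mem μ (support G A μ) ∅ L ∧ L.Nodup ∧ (∀ u, u ∈ L ↔ support G A μ u = 0) ∧
    (∀ ν : V → WithTop Q, (∀ v, StableAt G A ν v) → μ ≤ ν) ∧
    φ = 101 * ∑ v, I.potential (μ v) v + 1) ⟨μ₀, L₀, hm, hL, hLs, hμ₀, rfl⟩ ?_ ?_
  · rintro φ m ⟨μ, L, hm, hL, hLs, hμ, rfl⟩
    refine ⟨decide (m.reg 2 < m.reg 3), rfl, by omega, fun hlt => ?_⟩
    cases L with
    | nil => simp [hm.reg2, hm.reg3] at hlt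
    | cons v L =>
      have hst := support_eq_zero_iff.1 ((hLs v).1 List.mem_cons_self)
      refine (wp_liftTop hA hw hm hL hLs).mono ?_
      rintro m' T ⟨hT, L', hL', hLs', hm'⟩
      refine ⟨_, ?_, _, L', hm', hL', hLs', fun ν hν u => ?_, rfl⟩
      · have h := I.sum_potential_update hst
        -- The test of the loop is charged to the weight as well, whence `101` instead of `100`.
        have h1 : 1 ≤ I.weight v := by simp only [Input.weight]; omega
        omega
      · by_cases hu : u = v
        · subst hu
          simpa using I.lifted_le hA (hμ ν hν) (hν u)
        · simpa [hu] using hμ ν hν u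
  · rintro φ m' T hT ⟨μ, L, hm, hL, hLs, hμ, -⟩ ht
    cases L with
    | nil =>
      refine ⟨hT, μ, fun v => ?_, hμ, hm⟩
      by_contra h
      simpa using (hLs v).2 (support_eq_zero_iff.2 h)
    | cons v L => simp [Test.eval, hm.reg2, hm.reg3] at ht

theorem wp_solve (hA : A.IsLinear) (hw : Fits I w) [Nonempty V] [Nonempty Q] :
    wp I w (4 * Fintype.card V) solve (Store.initial V C) fun m' T =>
      T ≤ 1000 * (G.edges.card * Fintype.card Q + Fintype.card V) ∧
      ∃ μ : V → WithTop Q, (∀ v, StableAt G A μ v) ∧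
      (∀ ν : V → WithTop Q, (∀ v, StableAt G A ν v) → μ ≤ ν) ∧
      ∀ v, m'.mem (I.vertexNum v) ≠ 0 ↔ μ v ≠ ⊤ := by
  classical
  have hN : 0 < Fintype.card V := Fintype.card_pos
  have hQ : 0 < Fintype.card Q := Fintype.card_pos
  have hlt := hw.address_lt
  have hVw : Fintype.card V < 2 ^ w := by omega
  set x₀ := (Finset.univ : Finset Q).min with hx₀
  let μ₀ : V → WithTop Q := fun _ => x₀
  have hμ₀ : ∀ ν : V → WithTop Q, (∀ v, StableAt G A ν v) → μ₀ ≤ ν := by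
    intro ν _ v
    change x₀ ≤ ν v
    cases ν v using WithTop.recTopCoe with
    | top => exact le_top
    | coe q => exact Finset.min_le (Finset.mem_univ q)
  have b1 : Fintype.card V + Fintype.card V < 2 ^ w := by omega
  have b2 : Fintype.card V + Fintype.card V + Fintype.card V < 2 ^ w := by omega
  have b3 : 1 < 2 ^ w := by omega
  simp only [solve, wp_seq]
  simp [Store.initial, hVw, b1, b2, b3, hw.state_lt, hw.topNum_lt, ← hx₀]
  refine wp_forVertices (fun _ => 1) (fun i reg mem => (reg 0 = Fintype.card V ∧
      reg 1 = 2 * Fintype.card V ∧ reg 2 = 3 * Fintype.card V ∧ reg 3 = 3 * Fintype.card V ∧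
      reg 4 = 1 ∧ reg 5 = Fintype.card Q ∧ reg 6 = 0 ∧ reg 9 = I.topNum x₀) ∧
      (∀ v, (I.vertexNum v : ℕ) < i → mem (I.vertexNum v) = I.topNum x₀) ∧
      ∀ a, Fintype.card V ≤ a → mem a = 0) hVw
    ⟨by simp; omega, by simp, by simp⟩ (fun i reg mem h => ⟨h.1.1, h.1.2.2.2.2.1⟩) ?_ ?_
  · rintro v m h7 ⟨hreg, hmem, hmem'⟩
    have hb := hw.bounds v
    have hv := (I.vertexNum v).2
    simp [h7, hb, hreg]
    refine ⟨fun u hu => ?_, fun a ha => ?_⟩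
    · by_cases huv : u = v
      · simp [huv]
      · have : (I.vertexNum u : ℕ) ≠ I.vertexNum v := by simpa [Fin.val_inj] using huv
        rw [Function.update_of_ne this]
        exact hmem u (by omega)
    · rw [Function.update_of_ne (by omega)]
      exact hmem' a ha
  rintro m₁ T₁ hT₁ ⟨⟨r0, r1, r2, r3, r4, r5, r6, r9⟩, hmem, hmem'⟩
  -- Supports and marks read as zero because the memory is initially zero; the true supports come
  -- with the next loop.
  have hm₁ : Rep I m₁.reg m₁.mem μ₀ (fun _ => 0) ∅ [] :=
    ⟨r0, r1, r2, r3, r4, r5, r6, fun v => hmem v (I.vertexNum v).2,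
      fun v => hmem' _ (by omega), fun v => by simpa using hmem' _ (by omega), trivial⟩
  refine wp_forVertices (fun v => 40 * (I.outEdges v).length + 20) (fun i reg mem => ∃ s L,
    Rep I reg mem μ₀ s ∅ L ∧ reg 9 = I.topNum x₀ ∧ L.Nodup ∧
    (∀ u, (I.vertexNum u : ℕ) < i → s u = support G A μ₀ u) ∧
    (∀ u, u ∈ L ↔ (I.vertexNum u : ℕ) < i ∧ support G A μ₀ u = 0)) hVw
    ⟨_, [], by simpa using hm₁, by simpa using r9, by simp⟩
    (fun i reg mem ⟨s, L, h, _⟩ => ⟨h.reg0, h.reg4⟩) ?_ ?_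
  · rintro v m h7 ⟨s, L, hm, h9, hL, hs, hLs⟩
    have hvL : v ∉ L := fun h => lt_irrefl _ ((hLs v).1 h).1
    refine (wp_updateSupport hw hm (List.nodup_cons.2 ⟨hvL, hL⟩).length_le_card h7 h9).mono ?_
    rintro m' T ⟨hT, hm', h7', h9'⟩
    have hlt : ∀ u, u ≠ v → ((I.vertexNum u : ℕ) < I.vertexNum v + 1 ↔
        (I.vertexNum u : ℕ) < I.vertexNum v) := by
      intro u hu
      have : (I.vertexNum u : ℕ) ≠ I.vertexNum v := by simpa [Fin.val_inj] using hu
      omega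
    refine ⟨hT, h7', _, _, by simpa using hm', by simpa using h9', ?_, fun u hu => ?_,
      fun u => ?_⟩
    · split_ifs
      · exact List.nodup_cons.2 ⟨hvL, hL⟩
      · exact hL
    · by_cases huv : u = v
      · subst huv; simp
      · rw [Function.update_of_ne huv]
        exact hs u ((hlt u huv).1 hu)
    · by_cases huv : u = v
      · subst huv
        split_ifs with h <;> simp [h, hvL]
      · have := hLs u
        split_ifs <;> simp [huv, this, hlt u huv]
  rintro m₂ T₂ hT₂ ⟨s, L, hm₂, -, hL, hs, hLs⟩
  obtain rfl : s = support G A μ₀ := funext fun u => hs u (I.vertexNum u).2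
  refine (wp_loop_liftTop hA hw hm₂ hL (fun u => by simp [hLs]) hμ₀).mono ?_
  rintro m₃ T₃ ⟨hT₃, μ, hst, hleast, hm₃⟩
  refine wp_forVertices (fun _ => 4) (fun i reg mem => (reg 0 = Fintype.card V ∧ reg 4 = 1 ∧
      reg 5 = Fintype.card Q ∧ reg 6 = 0) ∧ ∀ v, mem (I.vertexNum v) =
        if (I.vertexNum v : ℕ) < i then (if μ v = ⊤ then 0 else 1) else I.topNum (μ v)) hVw
    ⟨by simp [hm₃.reg0, hm₃.reg4, hm₃.reg5, hm₃.reg6], by simp [hm₃.value]⟩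
    (fun i reg mem h => ⟨h.1.1, h.1.2.1⟩) ?_ ?_
  · rintro v m h7 ⟨hreg, hmem⟩
    have hb := hw.bounds v
    -- Values are overwritten one by one by Booleans, as the number of a state may itself be zero.
    -- The comparison `≤` is the bound `<` of the invariant after the increment.
    have key : ∀ u (a : ℕ), a = (if μ v = ⊤ then 0 else 1) →
        Function.update m.mem (I.vertexNum v) a (I.vertexNum u) =
        if I.vertexNum u ≤ I.vertexNum v then (if μ u = ⊤ then 0 else 1)
        else I.topNum (μ u) := by
      intro u a ha
      by_cases huv : u = v
      · subst huv; simp [ha]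
      · have : (I.vertexNum u : ℕ) ≠ I.vertexNum v := by simpa [Fin.val_inj] using huv
        rw [Function.update_of_ne this, hmem]
        congr 1
        rw [eq_iff_iff, Fin.le_def]
        omega
    simp [h7, hb, hreg, hmem, hw.topNum_lt, I.topNum_eq_card_iff]
    exact ⟨fun h u => key u 0 (by simp [h]), fun h u => key u 1 (by simp [h])⟩
  rintro m₄ T₄ hT₄ ⟨-, hmem⟩
  refine ⟨?_, μ, hst, hleast, fun v => ?_⟩
  -- The linear terms in `|E|` from initialising the supports are absorbed by `|E| |Q|`, as `Q` is
  -- nonempty.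
  · have hpot := I.sum_potential_le
    have hout := I.sum_length_outEdges
    have hmul : G.edges.card ≤ G.edges.card * Fintype.card Q := Nat.le_mul_of_pos_right _ hQ
    simp only [Finset.sum_add_distrib, ← Finset.mul_sum, hout, Finset.sum_const,
      Finset.card_univ, smul_eq_mul] at hT₁ hT₂ hT₄
    change T₃ ≤ 101 * ∑ v, I.potential (Finset.univ : Finset Q).min v + 1 at hT₃
    omega
  · rw [hmem, if_pos (I.vertexNum v).2]
    simp

end verification

/-! ### Word size, nonemptiness and the final constants -/

theorem fits_of_word_size {V Q C : Type*} [Fintype V] [Fintype Q] {G : Arena V C}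
    {A : ColGraph Q C} (I : Input G A) {K : ℕ} (hK : 4 ≤ K) :
    Fits I (Nat.log 2 (Fintype.card V) + Nat.log 2 (Fintype.card Q) + K) := by
  have hV := Nat.lt_pow_succ_log_self one_lt_two (Fintype.card V)
  have hQ := Nat.lt_pow_succ_log_self one_lt_two (Fintype.card Q)
  constructor
  · calc 4 * Fintype.card V < 4 * 2 ^ (Nat.log 2 (Fintype.card V)).succ := by omega
      _ = 2 ^ (Nat.log 2 (Fintype.card V) + 3) := by rw [Nat.succ_eq_add_one]; ring
      _ ≤ _ := Nat.pow_le_pow_right two_pos (by omega)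
  · exact hQ.trans_le (Nat.pow_le_pow_right two_pos (by omega))

/-- The one-vertex graph without edges satisfies every objective vacuously, so it maps into `A`. -/
theorem ColGraph.IsUniversal.nonempty {Q C : Type*} {A : ColGraph Q C} {n : ℕ} {Ω : Set (ℕ → C)}
    (hA : A.IsUniversal n Ω) (hn : 0 < n) : Nonempty Q := by
  obtain ⟨φ, -⟩ := hA.2 Unit ⟨∅⟩ (by rw [Fintype.card_unit]; exact hn) fun v π h => by simpa using (h.2 0).1
  exact ⟨φ ()⟩

theorem ColGraph.card_le_two_mul {V C : Type*} [Fintype V] {G : ColGraph V C}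
    (h : ∀ v : V, ∃ e ∈ G.edges, e.1 = v ∨ e.2.2 = v) :
    Fintype.card V ≤ 2 * G.edges.card := by
  classical
  calc Fintype.card V ≤ (G.edges.image (fun e => e.1) ∪ G.edges.image fun e => e.2.2).card := by
        refine Finset.card_le_card fun v _ => ?_
        obtain ⟨e, he, hv⟩ := h v
        rw [Finset.mem_union, Finset.mem_image, Finset.mem_image]
        exact hv.imp (fun h => ⟨e, he, h⟩) fun h => ⟨e, he, h⟩
    _ ≤ _ := (Finset.card_union_le _ _).trans (by
        have h₁ := Finset.card_image_le (s := G.edges) (f := fun e : V × C × V => e.1)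
        have h₂ := Finset.card_image_le (s := G.edges) (f := fun e : V × C × V => e.2.2)
        omega)

end UniversalGraphs

theorem mainTheorem3 :
    ∃ (p : UniversalGraphs.Prog) (K : ℕ),
      ∀ (C : Type*) (Ω : Set (ℕ → C)) (_ : UniversalGraphs.PositionallyDetermined Ω)
        (_ : UniversalGraphs.PrefixIndependent Ω) (n : ℕ)
        (V : Type) [Fintype V] [Nonempty V] (G : UniversalGraphs.Arena V C)
        (_ : Fintype.card V = n)
        (Q : Type) [Fintype Q] [LinearOrder Q] (A : UniversalGraphs.ColGraph Q C)
        (_ : A.IsLinear) (_ : A.IsUniversal n Ω) (I : UniversalGraphs.Input G A),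
        ∃ (S T : ℕ) (m : UniversalGraphs.Store V C),
          UniversalGraphs.Exec I
            (Nat.log 2 (Fintype.card V) + Nat.log 2 (Fintype.card Q) + K) S p
            (UniversalGraphs.Store.initial V C) m T ∧
          (∀ v : V, m.mem (I.vertexNum v) ≠ 0 ↔ v ∈ G.winningRegion Ω) ∧
          T ≤ K * (G.edges.card * Fintype.card Q + Fintype.card V) ∧
          ((∀ v : V, ∃ e ∈ G.edges, e.1 = v ∨ e.2.2 = v) →
            T ≤ K * (G.edges.card * Fintype.card Q)) ∧
          S ≤ K * Fintype.card V := by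
  classical
  -- If every vertex meets an edge, then `|V| ≤ 2 |E| ≤ 2 |E| |Q|`, and `1000 (|E| |Q| + |V|)`
  -- becomes `3000 |E| |Q|`.
  refine ⟨UniversalGraphs.solve, 3000, ?_⟩
  rintro C Ω hpos hpre n V _ _ G rfl Q _ _ A hA hU I
  have := hU.nonempty Fintype.card_pos
  obtain ⟨m, T, hexec, hT, μ, hst, hleast, hm⟩ := UniversalGraphs.wp_solve (I := I) hA
    (UniversalGraphs.fits_of_word_size I (K := 3000) (by norm_num))
  refine ⟨_, T, m, hexec, fun v => (hm v).trans ⟨?_, fun hv htop => ?_⟩, by omega,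
    fun hinc => ?_, by omega⟩
  · exact UniversalGraphs.mem_winningRegion_of_stable hA hU.1 hst
  · obtain ⟨ν, hν, hne⟩ :=
      UniversalGraphs.exists_stable_of_mem_winningRegion hpos hpre hA hU hv
    -- The measure `ν` depends on `v`, which is harmless: the least measure lies below all of them.
    exact hne (top_le_iff.1 (htop ▸ hleast ν hν v))
  · have hV := UniversalGraphs.ColGraph.card_le_two_mul hinc
    have hmul : G.edges.card ≤ G.edges.card * Fintype.card Q :=
      Nat.le_mul_of_pos_right _ Fintype.card_pos
    omega
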